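/- Let $k$ be a field. Algebras are associative $k$-algebras, possibly without unit, with nondegenerate product; $M(A)$ is the multiplier algebra of $A$ and $\otimes=\otimes_k$. A multiplier Hopf algebra is an algebra $A$ with a homomorphism $\Delta:A\to M(A\otimes A)$ such that $T_1(a\otimes b)=\Delta(a)(1\otimes b)$ and $T_2(a\otimes b)=(a\otimes 1)\Delta(b)$ define bijective maps of $A\otimes A$ to itself with $(T_2\otimes id)(id\otimes T_1)=(id\otimes T_1)(T_2\otimes id)$; it is regular if $(A,\tau\Delta)$, $\tau$ the flip, is also a multiplier Hopf algebra. Let $A$ and $B$ be multiplier Hopf algebras with counits $\varepsilon_A,\varepsilon_B$ and with antipodes that take values in the algebras, $S_A:A\to A$, $S_B:B\to B$. Let $R:B\otimes A\to A\otimes B$ and $T:A\otimes B\to A\otimes B$ be bijective linear maps, written $R(b\otimes a)=a_R\otimes b_R$, $T(a\otimes b)=a_T\otimes b_T$ (lower case $r,t$ for further copies), such that for all $a,c\in A$ and $b,d\in B$ (2.1) $a_R\otimes(bd)_R=a_{Rr}\otimes b_rd_R$; (2.2) $(ac)_R\otimes b_R=a_Rc_r\otimes b_{Rr}$; (2.3)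 $a_T\otimes(bd)_T=a_{Tt}\otimes b_Td_t$; (2.4) $(ac)_T\otimes b_T=a_Tc_t\otimes b_{tT}$; (2.5) $a_T\otimes c_R\otimes d_{TR}=a_T\otimes c_R\otimes d_{RT}$ and $c_{TR}\otimes b_R\otimes d_T=c_{RT}\otimes b_R\otimes d_T$. Let $A\#_{RT}B$ be the space $A\otimes B$, with $a\otimes b$ written $a\#b$, and with the product $(a\#b)(c\#d)=a_Tc_R\#b_Rd_T$. Put $$(T*R)(b\otimes y\otimes a\otimes x)=b_{RT}\,a_r\otimes(y_{Rr}\,x)_T,\qquad (R*T)(a\otimes x\otimes b\otimes y)=(a\,b_{Rr})_T\otimes x_r\,y_{RT}.$$ Let $\varepsilon_{RT}=\varepsilon_A\otimes\varepsilon_B$, $S_{RT}=T\circ R\circ(S_B\otimes S_A)\circ\tau$, and let $\Delta_{RT}=(id\otimes\tau\otimes id)(\Delta_A\otimes\Delta_B)$, that is, $\Delta_{RT}(a\#x)=(a_1\#x_1)\otimes(a_2\#x_2)$. Precisely, a pair $X$ of a left and a right multiplication operator on $(A\#_{RT}B)^{\otimes2}$ equals $\Delta_{RT}(u)$, where $u=\sum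 a\#x$, if for every $w\in A\#_{RT}B$ there are $Z,Z'\in(A\#_{RT}B)^{\otimes 2}$ with $X(1\otimes w)=Z$ and $(w\otimes1)X=Z'$ and, for all $c\in A$, $z\in B$, in terms of the ordinary products of $A$ and $B$ in the legs of $A\otimes B\otimes A\otimes B$ that are multiplied by $c$ and $z$, $$(c\otimes z\otimes1)\,Z=\sum(ca_1\otimes zx_1)\otimes(a_2\#x_2)w,\qquad Z'\,(1\otimes c\otimes z)=\sum w(a_1\#x_1)\otimes(a_2c\otimes x_2z),$$ where $ca_1\otimes a_2=(c\otimes1)\Delta_A(a)$, $a_1\otimes a_2c=\Delta_A(a)(1\otimes c)$, and likewise for $B$; these equations, which determine $Z$ and $Z'$, are the meaning of $Z=\Delta_{RT}(u)(1\otimes w)$ and $Z'=(w\otimes 1)\Delta_{RT}(u)$. Let $\Delta_A(a)\#(1\otimes1)$ and $(1\otimes1)\#\Delta_B(x)$ be the pairs of operators on $(A\#_{RT}B)^{\otimes2}$ that in each of the two tensor factors extend $(a\#1)(c\#d)=a_Tc\#d_T$, $(c\#d)(a\#1)=ca_R\#d_R$, and $(1\#b)(c\#d)=c_R\#b_Rd$,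 $(c\#d)(1\#b)=c_T\#db_T$; explicitly, $\Delta_A(a)$ acts from the left after transport by $T$ and from the right after transport by $R$, and $\Delta_B(x)$ acts from the left after transport by $R$ and from the right after transport by $T$. Assume further: (i) for $v\in A\otimes B$: if $(T*R)(v\otimes a\otimes b)=0$ for all $a\in A$, $b\in B$, then $v=0$; if $(R*T)(a\otimes b\otimes v)=0$ for all $a\in A$, $b\in B$, then $v=0$; (2.15) $\Delta_{RT}(R(x\otimes a))=\big((1\otimes1)\#\Delta_B(x)\big)\big(\Delta_A(a)\#(1\otimes1)\big)$ for $a\in A$, $x\in B$; (2.16) $\Delta_{RT}\circ T=(T\otimes T)\circ\Delta_{RT}$, where, as $T(a\otimes x)=(a\#1)(1\#x)$, the right-hand side at $a\otimes x$ is the multiplier $\big(\Delta_A(a)\#(1\otimes1)\big)\big((1\otimes1)\#\Delta_B(x)\big)$; (2.17) $(T*R)(S_A\otimes S_B\otimes id)\big(\Delta_{RT}(u)(1\otimes w)\big)=\varepsilon_{RT}(u)w$ for $u,w\in A\#_{RT}B$; (2.18) $(R*T)(id\otimes S_A\otimes S_B)\big((w\otimes1)\Delta_{RT}(u)\big)=\varepsilon_{RT}(u)w$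 for $u,w\in A\#_{RT}B$. Then for every $u\in A\#_{RT}B$ there is exactly one such $X$ equal to $\Delta_{RT}(u)$, it is a multiplier of $(A\#_{RT}B)^{\otimes2}$, and $A\#_{RT}B$ is an associative algebra with nondegenerate product which is, with $\Delta_{RT}$, a multiplier Hopf algebra with counit $\varepsilon_{RT}$ and antipode $S_{RT}$. If $A$ and $B$ are regular, so is $A\#_{RT}B$. -/

import Mathlib

open scoped TensorProduct

noncomputable section

namespace MultHopf

/-! ### Multipliers -/

section Multipliers

variable (k : Type*) (A : Type*) [Field k] [NonUnitalNonAssocRing A] [Module k A]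
  [IsScalarTower k A A] [SMulCommClass k A A]

/-- Pairs `(m₁, m₂)` of linear endomorphisms, `m₁` standing for a left and `m₂` for a right
multiplication operator, with the product `(m₁, m₂) (n₁, n₂) = (m₁ ∘ n₁, n₂ ∘ m₂)`. -/
abbrev EndPair (k : Type*) (V : Type*) [Field k] [AddCommGroup V] [Module k V] : Type _ :=
  Module.End k V × (Module.End k V)ᵐᵒᵖ

/-- The multiplier algebra `M(A)`: the pairs `(m₁, m₂)` with `m₂(a) b = a m₁(b)`. -/
def Multiplier : Subalgebra k (EndPair k A) where
  carrier := {m | ∀ a b : A, m.2.unop a * b = a * m.1 b}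
  mul_mem' := by
    intro m n hm hn a b
    have h1 := hn (m.2.unop a) b
    have h2 := hm a (n.1 b)
    simpa using h1.trans h2
  add_mem' := by
    intro m n hm hn a b
    simp only [Set.mem_ofPred_eq] at hm hn
    simp [add_mul, mul_add, hm, hn]
  algebraMap_mem' := by
    intro r a b
    simp [Algebra.algebraMap_eq_smul_one, smul_mul_assoc, mul_smul_comm]

variable {k A}

/-- `X (1 ⊗ w) = Z` for a pair `X` on `A ⊗ A`, an element `w` of `A` and an element `Z` of
`A ⊗ A`, viewed as the multiplier `(Z ·, · Z)`: equality of the left and of the right components. -/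
def EqMulOneTmul (X : EndPair k (A ⊗[k] A)) (w : A) (Z : A ⊗[k] A) : Prop :=
  (∀ s : A ⊗[k] A, X.1 ((LinearMap.mulLeft k w).lTensor A s) = Z * s) ∧
  (∀ s : A ⊗[k] A, (LinearMap.mulRight k w).lTensor A (X.2.unop s) = s * Z)

/-- `(w ⊗ 1) X = Z` for a pair `X` on `A ⊗ A`, an element `w` of `A` and an element `Z` of
`A ⊗ A`, viewed as the multiplier `(Z ·, · Z)`: equality of the left and of the right components. -/
def EqTmulOneMul (w : A) (X : EndPair k (A ⊗[k] A)) (Z : A ⊗[k] A) : Prop :=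
  (∀ s : A ⊗[k] A, (LinearMap.mulLeft k w).rTensor A (X.1 s) = Z * s) ∧
  (∀ s : A ⊗[k] A, X.2.unop ((LinearMap.mulRight k w).rTensor A s) = s * Z)

end Multipliers

/-! ### Multiplier Hopf algebras -/

section MHA

/-- A multiplier Hopf algebra structure on the algebra `A`. The maps `T₁`, `T₂` are determined
by the comultiplication, because the product of `A ⊗ A` is nondegenerate. -/
structure MultiplierHopfAlgebra (k : Type*) (A : Type*) [Field k] [NonUnitalNonAssocRing A]
    [Module k A] [IsScalarTower k A A] [SMulCommClass k A A] where
  /-- the product is associative -/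
  assoc : ∀ a b c : A, a * b * c = a * (b * c)
  /-- the product is nondegenerate -/
  nondeg_left : ∀ a : A, (∀ b : A, a * b = 0) → a = 0
  nondeg_right : ∀ a : A, (∀ b : A, b * a = 0) → a = 0
  /-- the comultiplication `Δ : A → M(A ⊗ A)` -/
  comul : A →ₗ[k] Multiplier k (A ⊗[k] A)
  comul_mul : ∀ a b : A, comul (a * b) = comul a * comul b
  /-- the bijection `T₁(a ⊗ b) = Δ(a) (1 ⊗ b)` of `A ⊗ A` -/
  T₁ : (A ⊗[k] A) ≃ₗ[k] (A ⊗[k] A)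
  T₁_spec : ∀ a b : A, EqMulOneTmul (comul a : EndPair k (A ⊗[k] A)) b (T₁ (a ⊗ₜ b))
  /-- the bijection `T₂(a ⊗ b) = (a ⊗ 1) Δ(b)` of `A ⊗ A` -/
  T₂ : (A ⊗[k] A) ≃ₗ[k] (A ⊗[k] A)
  T₂_spec : ∀ a b : A, EqTmulOneMul a (comul b : EndPair k (A ⊗[k] A)) (T₂ (a ⊗ₜ b))
  /-- `(T₂ ⊗ id) (id ⊗ T₁) = (id ⊗ T₁) (T₂ ⊗ id)` on `A ⊗ A ⊗ A` -/
  coassoc : ∀ t : (A ⊗[k] A) ⊗[k] A,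
    TensorProduct.assoc k A A A (T₂.toLinearMap.rTensor A ((TensorProduct.assoc k A A A).symm
      (T₁.toLinearMap.lTensor A (TensorProduct.assoc k A A A t)))) =
    T₁.toLinearMap.lTensor A (TensorProduct.assoc k A A A (T₂.toLinearMap.rTensor A t))

variable {k : Type*} {A : Type*} [Field k] [NonUnitalNonAssocRing A]
  [Module k A] [IsScalarTower k A A] [SMulCommClass k A A]

/-- `(A, Δ)` is regular: `(A, τ Δ)`, with `τ` the flip, is also a multiplier Hopf algebra. -/
def IsRegular (H : MultiplierHopfAlgebra k A) : Prop :=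
  ∃ H' : MultiplierHopfAlgebra k A, ∀ (a : A) (s : A ⊗[k] A),
    (H'.comul a).1.1 s =
      TensorProduct.comm k A A ((H.comul a).1.1 (TensorProduct.comm k A A s)) ∧
    (H'.comul a).1.2.unop s =
      TensorProduct.comm k A A ((H.comul a).1.2.unop (TensorProduct.comm k A A s))

/-- `ε` is the counit: a homomorphism with `(ε ⊗ id)(Δ(a)(1 ⊗ b)) = a b` and
`(id ⊗ ε)((a ⊗ 1)Δ(b)) = a b`. -/
structure IsCounit (H : MultiplierHopfAlgebra k A) (ε : A →ₗ[k] k) : Prop where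
  map_mul : ∀ a b : A, ε (a * b) = ε a * ε b
  left : ∀ a b : A, TensorProduct.lid k A (ε.rTensor A (H.T₁ (a ⊗ₜ b))) = a * b
  right : ∀ a b : A, TensorProduct.rid k A (ε.lTensor A (H.T₂ (a ⊗ₜ b))) = a * b

/-- `S : A → A` is the antipode (which therefore takes its values in `A ⊆ M(A)`):
an anti-homomorphism with `m(S ⊗ id)(Δ(a)(1 ⊗ b)) = ε(a) b` and
`m(id ⊗ S)((a ⊗ 1)Δ(b)) = ε(b) a`. -/
structure IsAntipode (H : MultiplierHopfAlgebra k A) (ε : A →ₗ[k] k) (S : A →ₗ[k] A) :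
    Prop where
  map_mul : ∀ a b : A, S (a * b) = S b * S a
  left : ∀ a b : A, LinearMap.mul' k A (S.rTensor A (H.T₁ (a ⊗ₜ b))) = ε a • b
  right : ∀ a b : A, LinearMap.mul' k A (S.lTensor A (H.T₂ (a ⊗ₜ b))) = ε b • a

end MHA

/-! ### The generalized L-R-twisted tensor product -/

section Twisted

variable {k : Type*} {A : Type*} {B : Type*} [Field k]
  [NonUnitalRing A] [Module k A] [IsScalarTower k A A] [SMulCommClass k A A]
  [NonUnitalRing B] [Module k B] [IsScalarTower k B B] [SMulCommClass k B B]

/-- `T₁₃` on `A ⊗ X ⊗ B`. -/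
def leg13 (T : (A ⊗[k] B) ≃ₗ[k] (A ⊗[k] B)) (X : Type*) [AddCommGroup X] [Module k X] :
    (A ⊗[k] X) ⊗[k] B →ₗ[k] (A ⊗[k] X) ⊗[k] B :=
  (TensorProduct.rightComm k A B X).toLinearMap ∘ₗ T.toLinearMap.rTensor X ∘ₗ
    (TensorProduct.rightComm k A X B).toLinearMap

/-- `R₂₃ : A ⊗ B ⊗ A ⊗ B → A ⊗ A ⊗ B ⊗ B`. -/
def leg23 (R : (B ⊗[k] A) ≃ₗ[k] (A ⊗[k] B)) :
    (A ⊗[k] B) ⊗[k] (A ⊗[k] B) →ₗ[k] (A ⊗[k] A) ⊗[k] (B ⊗[k] B) :=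
  (TensorProduct.assoc k A A (B ⊗[k] B)).symm.toLinearMap ∘ₗ
    ((TensorProduct.assoc k A B B).toLinearMap ∘ₗ R.toLinearMap.rTensor B ∘ₗ
      (TensorProduct.assoc k B A B).symm.toLinearMap).lTensor A ∘ₗ
    (TensorProduct.assoc k A B (A ⊗[k] B)).toLinearMap

/-- `T₁₄` on `A ⊗ A ⊗ B ⊗ B`. -/
def leg14 (T : (A ⊗[k] B) ≃ₗ[k] (A ⊗[k] B)) :
    (A ⊗[k] A) ⊗[k] (B ⊗[k] B) →ₗ[k] (A ⊗[k] A) ⊗[k] (B ⊗[k] B) :=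
  ((TensorProduct.assoc k A A B).symm.toLinearMap.rTensor B ∘ₗ leg13 T (A ⊗[k] B) ∘ₗ
      (TensorProduct.assoc k A A B).toLinearMap.rTensor B
    |> fun f => (TensorProduct.assoc k (A ⊗[k] A) B B).toLinearMap ∘ₗ f ∘ₗ
      (TensorProduct.assoc k (A ⊗[k] A) B B).symm.toLinearMap)

/-- The conditions on `R : B ⊗ A → A ⊗ B` and `T : A ⊗ B → A ⊗ B`, in the notation
`R(b ⊗ a) = a_R ⊗ b_R`, `T(a ⊗ b) = a_T ⊗ b_T`. -/
structure IsLRTwisting (R : (B ⊗[k] A) ≃ₗ[k] (A ⊗[k] B)) (T : (A ⊗[k] B) ≃ₗ[k] (A ⊗[k] B)) :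
    Prop where
  /-- `R (m_B ⊗ id) = (id ⊗ m_B) R₁₂ R₂₃` on `B ⊗ B ⊗ A` -/
  R_mul_left : ∀ (b d : B) (a : A), R ((b * d) ⊗ₜ a) =
    (LinearMap.mul' k B).lTensor A (TensorProduct.assoc k A B B
      (R.toLinearMap.rTensor B ((TensorProduct.assoc k B A B).symm (b ⊗ₜ R (d ⊗ₜ a)))))
  /-- `R (id ⊗ m_A) = (m_A ⊗ id) R₂₃ R₁₂` on `B ⊗ A ⊗ A` -/
  R_mul_right : ∀ (b : B) (a c : A), R (b ⊗ₜ (a * c)) =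
    (LinearMap.mul' k A).rTensor B ((TensorProduct.assoc k A A B).symm
      (R.toLinearMap.lTensor A (TensorProduct.assoc k A B A (R (b ⊗ₜ a) ⊗ₜ c))))
  /-- `T (id ⊗ m_B) = (id ⊗ m_B) T₁₃ T₁₂` on `A ⊗ B ⊗ B` -/
  T_mul_right : ∀ (a : A) (b d : B), T (a ⊗ₜ (b * d)) =
    (LinearMap.mul' k B).lTensor A (TensorProduct.assoc k A B B
      (leg13 T B (T (a ⊗ₜ b) ⊗ₜ d)))
  /-- `T (m_A ⊗ id) = (m_A ⊗ id) T₁₃ T₂₃` on `A ⊗ A ⊗ B` -/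
  T_mul_left : ∀ (a c : A) (b : B), T ((a * c) ⊗ₜ b) =
    (LinearMap.mul' k A).rTensor B
      (leg13 T A ((TensorProduct.assoc k A A B).symm (a ⊗ₜ T (c ⊗ₜ b))))
  /-- `R₂₃ T₁₂ = T₁₃ R₂₃` on `A ⊗ B ⊗ A`, that is, `a_T ⊗ c_R ⊗ d_{TR} = a_T ⊗ c_R ⊗ d_{RT}` -/
  comm_B : ∀ (a c : A) (d : B),
    (TensorProduct.assoc k A A B).symm
      (R.toLinearMap.lTensor A (TensorProduct.assoc k A B A (T (a ⊗ₜ d) ⊗ₜ c))) =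
    leg13 T A ((TensorProduct.assoc k A A B).symm (a ⊗ₜ R (d ⊗ₜ c)))
  /-- `R₁₂ T₂₃ = T₁₃ R₁₂` on `B ⊗ A ⊗ B`, that is, `c_{TR} ⊗ b_R ⊗ d_T = c_{RT} ⊗ b_R ⊗ d_T` -/
  comm_A : ∀ (b d : B) (c : A),
    R.toLinearMap.rTensor B ((TensorProduct.assoc k B A B).symm (b ⊗ₜ T (c ⊗ₜ d))) =
    leg13 T B (R (b ⊗ₜ c) ⊗ₜ d)

/-- The space `A #_{RT} B = A ⊗ B`, to be given the twisted product. -/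
def LRTensor (_R : (B ⊗[k] A) ≃ₗ[k] (A ⊗[k] B)) (_T : (A ⊗[k] B) ≃ₗ[k] (A ⊗[k] B)) : Type _ :=
  A ⊗[k] B

variable (R : (B ⊗[k] A) ≃ₗ[k] (A ⊗[k] B)) (T : (A ⊗[k] B) ≃ₗ[k] (A ⊗[k] B))

instance : AddCommGroup (LRTensor R T) := inferInstanceAs (AddCommGroup (A ⊗[k] B))

instance : Module k (LRTensor R T) := inferInstanceAs (Module k (A ⊗[k] B))

/-- The identification `a ⊗ b ↦ a # b` of vector spaces. -/
def hash : (A ⊗[k] B) ≃ₗ[k] LRTensor R T := LinearEquiv.refl k (A ⊗[k] B)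

/-- The identification of `(A ⊗ B) ⊗ (A ⊗ B)` with `(A #_{RT} B) ⊗ (A #_{RT} B)`. -/
def hash₂ : ((A ⊗[k] B) ⊗[k] (A ⊗[k] B)) ≃ₗ[k] (LRTensor R T ⊗[k] LRTensor R T) :=
  TensorProduct.congr (hash R T) (hash R T)

/-- The product `(m_A ⊗ m_B) T₁₄ R₂₃`, that is, `(a # b)(c # d) = a_T c_R # b_R d_T`. -/
def lrMul : (LRTensor R T ⊗[k] LRTensor R T) →ₗ[k] LRTensor R T :=
  (hash R T).toLinearMap ∘ₗ TensorProduct.map (LinearMap.mul' k A) (LinearMap.mul' k B) ∘ₗ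
    leg14 T ∘ₗ leg23 R ∘ₗ (hash₂ R T).symm.toLinearMap

instance : NonUnitalNonAssocRing (LRTensor R T) :=
  { (inferInstance : AddCommGroup (LRTensor R T)) with
    mul := fun u v => lrMul R T (u ⊗ₜ v)
    left_distrib := fun u v w => by
      change lrMul R T (u ⊗ₜ (v + w)) = lrMul R T (u ⊗ₜ v) + lrMul R T (u ⊗ₜ w)
      rw [TensorProduct.tmul_add, map_add]
    right_distrib := fun u v w => by
      change lrMul R T ((u + v) ⊗ₜ w) = lrMul R T (u ⊗ₜ w) + lrMul R T (v ⊗ₜ w)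
      rw [TensorProduct.add_tmul, map_add]
    zero_mul := fun u => by
      change lrMul R T (0 ⊗ₜ u) = 0
      rw [TensorProduct.zero_tmul, map_zero]
    mul_zero := fun u => by
      change lrMul R T (u ⊗ₜ 0) = 0
      rw [TensorProduct.tmul_zero, map_zero] }

instance : IsScalarTower k (LRTensor R T) (LRTensor R T) where
  smul_assoc c u v := by
    change lrMul R T ((c • u) ⊗ₜ v) = c • lrMul R T (u ⊗ₜ v)
    rw [← TensorProduct.smul_tmul', map_smul]

instance : SMulCommClass k (LRTensor R T) (LRTensor R T) where
  smul_comm c u v := by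
    change c • lrMul R T (u ⊗ₜ v) = lrMul R T (u ⊗ₜ (c • v))
    rw [TensorProduct.tmul_smul, map_smul]

/-- `(T * R)(b ⊗ y ⊗ a ⊗ x) = (b_T a)_R ⊗ (y_R x)_T`, where `R` acts before `T`: with
`(b a)_R ⊗ y_R = b_R a_r ⊗ y_{Rr}` this is `b_{RT} a_r ⊗ (y_{Rr} x)_T`. -/
def TstarR : (A ⊗[k] B) ⊗[k] (A ⊗[k] B) →ₗ[k] A ⊗[k] B :=
  (LinearMap.mul' k A).rTensor B ∘ₗ leg13 T A ∘ₗ (LinearMap.mul' k B).lTensor (A ⊗[k] A) ∘ₗ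
    leg23 R ∘ₗ
    (R.toLinearMap ∘ₗ (TensorProduct.comm k A B).toLinearMap).rTensor (A ⊗[k] B)

/-- `(R * T)(a ⊗ x ⊗ b ⊗ y) = (a b_R)_T ⊗ (x y_T)_R`, where `R` acts before `T`: with
`b_R ⊗ (x y)_R = b_{Rr} ⊗ x_r y_R` this is `(a b_{Rr})_T ⊗ x_r y_{RT}`. -/
def RstarT : (A ⊗[k] B) ⊗[k] (A ⊗[k] B) →ₗ[k] A ⊗[k] B :=
  (LinearMap.mul' k B).lTensor A ∘ₗ (TensorProduct.assoc k A B B).toLinearMap ∘ₗ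
    leg13 T B ∘ₗ (TensorProduct.assoc k A B B).symm.toLinearMap ∘ₗ
    (LinearMap.mul' k A).rTensor (B ⊗[k] B) ∘ₗ leg23 R ∘ₗ
    (R.toLinearMap ∘ₗ (TensorProduct.comm k A B).toLinearMap).lTensor (A ⊗[k] B)

/-! ### The multipliers `M # (1 ⊗ 1)` and `(1 ⊗ 1) # N` of `(A #_{RT} B) ⊗ (A #_{RT} B)`

They extend the operators of multiplication by `(a # 1) ⊗ (a' # 1)` and `(1 # b) ⊗ (1 # b')`:
`(a # 1)(c # d) = a_T c # d_T`, `(c # d)(a # 1) = c a_R # d_R`, `(1 # b)(c # d) = c_R # b_R d`,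
`(c # d)(1 # b) = c_T # d b_T`. For instance `a_T c ⊗ d_T = T(a c' ⊗ d')` with
`c' ⊗ d' = T⁻¹(c ⊗ d)`, an expression in which `a` may be replaced by a multiplier. -/

/-- `A ⊗ A ⊗ B ⊗ B → (A #_{RT} B) ⊗ (A #_{RT} B)`, by `T` on the legs 1, 3 and on the legs 2, 4. -/
def legsT : ((A ⊗[k] A) ⊗[k] (B ⊗[k] B)) ≃ₗ[k] (LRTensor R T ⊗[k] LRTensor R T) :=
  (TensorProduct.tensorTensorTensorComm k A A B B).trans
    ((TensorProduct.congr T T).trans (hash₂ R T))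

/-- `B ⊗ B ⊗ A ⊗ A → (A #_{RT} B) ⊗ (A #_{RT} B)`, by `R` on the legs 1, 3 and on the legs 2, 4. -/
def legsR : ((B ⊗[k] B) ⊗[k] (A ⊗[k] A)) ≃ₗ[k] (LRTensor R T ⊗[k] LRTensor R T) :=
  (TensorProduct.tensorTensorTensorComm k B B A A).trans
    ((TensorProduct.congr R R).trans (hash₂ R T))

/-- `M # (1 ⊗ 1)` for a multiplier `M` of `A ⊗ A`. -/
def hashA (M : Multiplier k (A ⊗[k] A)) : EndPair k (LRTensor R T ⊗[k] LRTensor R T) :=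
  ((legsT R T).toLinearMap ∘ₗ M.1.1.rTensor (B ⊗[k] B) ∘ₗ (legsT R T).symm.toLinearMap,
    MulOpposite.op ((legsR R T).toLinearMap ∘ₗ M.1.2.unop.lTensor (B ⊗[k] B) ∘ₗ
      (legsR R T).symm.toLinearMap))

/-- `(1 ⊗ 1) # N` for a multiplier `N` of `B ⊗ B`. -/
def hashB (N : Multiplier k (B ⊗[k] B)) : EndPair k (LRTensor R T ⊗[k] LRTensor R T) :=
  ((legsR R T).toLinearMap ∘ₗ N.1.1.rTensor (A ⊗[k] A) ∘ₗ (legsR R T).symm.toLinearMap,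
    MulOpposite.op ((legsT R T).toLinearMap ∘ₗ N.1.2.unop.lTensor (A ⊗[k] A) ∘ₗ
      (legsT R T).symm.toLinearMap))

/-! ### The comultiplication `Δ_{RT} = (id ⊗ τ ⊗ id)(Δ_A ⊗ Δ_B)` -/

variable (HA : MultiplierHopfAlgebra k A) (HB : MultiplierHopfAlgebra k B)

/-- `a # x ↦ (c a₁ ⊗ z x₁) ⊗ (a₂ # x₂)`, where `c a₁ ⊗ a₂ = (c ⊗ 1)Δ_A(a) ∈ A ⊗ A` and
`z x₁ ⊗ x₂ = (z ⊗ 1)Δ_B(x) ∈ B ⊗ B`. -/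
def comulCoveredLeft (c : A) (z : B) :
    LRTensor R T →ₗ[k] LRTensor R T ⊗[k] LRTensor R T :=
  (hash₂ R T).toLinearMap ∘ₗ
    (TensorProduct.tensorTensorTensorComm k A A B B).toLinearMap ∘ₗ
    TensorProduct.map (HA.T₂.toLinearMap ∘ₗ TensorProduct.mk k A A c)
      (HB.T₂.toLinearMap ∘ₗ TensorProduct.mk k B B z) ∘ₗ (hash R T).symm.toLinearMap

/-- `a # x ↦ (a₁ # x₁) ⊗ (a₂ c ⊗ x₂ z)`, where `a₁ ⊗ a₂ c = Δ_A(a)(1 ⊗ c) ∈ A ⊗ A` and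
`x₁ ⊗ x₂ z = Δ_B(x)(1 ⊗ z) ∈ B ⊗ B`. -/
def comulCoveredRight (c : A) (z : B) :
    LRTensor R T →ₗ[k] LRTensor R T ⊗[k] LRTensor R T :=
  (hash₂ R T).toLinearMap ∘ₗ
    (TensorProduct.tensorTensorTensorComm k A A B B).toLinearMap ∘ₗ
    TensorProduct.map (HA.T₁.toLinearMap ∘ₗ (TensorProduct.mk k A A).flip c)
      (HB.T₁.toLinearMap ∘ₗ (TensorProduct.mk k B B).flip z) ∘ₗ (hash R T).symm.toLinearMap

/-- The map `a # x ↦ c a # z x` of left multiplication in the ordinary tensor product. -/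
def tensorMulLeft (c : A) (z : B) : LRTensor R T →ₗ[k] LRTensor R T :=
  (hash R T).toLinearMap ∘ₗ TensorProduct.map (LinearMap.mulLeft k c) (LinearMap.mulLeft k z) ∘ₗ
    (hash R T).symm.toLinearMap

/-- The map `a # x ↦ a c # x z` of right multiplication in the ordinary tensor product. -/
def tensorMulRight (c : A) (z : B) : LRTensor R T →ₗ[k] LRTensor R T :=
  (hash R T).toLinearMap ∘ₗ TensorProduct.map (LinearMap.mulRight k c) (LinearMap.mulRight k z) ∘ₗ
    (hash R T).symm.toLinearMap

/-- `Z = Δ_{RT}(u)(1 ⊗ w)`, that is, `Z = (a₁ # x₁) ⊗ (a₂ # x₂) w` for `u = a # x`. As `Δ_A(a)` and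
`Δ_B(x)` are multipliers only, the formula is read with the first legs covered by arbitrary `c`
and `z`: `(c ⊗ z ⊗ 1) Z = (c a₁ ⊗ z x₁) ⊗ (a₂ # x₂) w`. This determines `Z`. -/
def IsComulMulOneTmul (u w : LRTensor R T) (Z : LRTensor R T ⊗[k] LRTensor R T) : Prop :=
  ∀ (c : A) (z : B), (tensorMulLeft R T c z).rTensor (LRTensor R T) Z =
    (LinearMap.mulRight k w).lTensor (LRTensor R T) (comulCoveredLeft R T HA HB c z u)

/-- `Z = (w ⊗ 1)Δ_{RT}(u)`, that is, `Z = w (a₁ # x₁) ⊗ (a₂ # x₂)` for `u = a # x`, read with the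
second legs covered by arbitrary `c` and `z`:
`Z (1 ⊗ c ⊗ z) = w (a₁ # x₁) ⊗ (a₂ c ⊗ x₂ z)`. This determines `Z`. -/
def IsTmulOneMulComul (w u : LRTensor R T) (Z : LRTensor R T ⊗[k] LRTensor R T) : Prop :=
  ∀ (c : A) (z : B), (tensorMulRight R T c z).lTensor (LRTensor R T) Z =
    (LinearMap.mulLeft k w).rTensor (LRTensor R T) (comulCoveredRight R T HA HB c z u)

/-- `X = Δ_{RT}(u)`: for all `w`, the products `X (1 ⊗ w)` and `(w ⊗ 1) X` lie in
`(A #_{RT} B) ⊗ (A #_{RT} B)` and are given by the formula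
`Δ_{RT}(a # x) = (a₁ # x₁) ⊗ (a₂ # x₂)`. -/
def IsComul (u : LRTensor R T) (X : EndPair k (LRTensor R T ⊗[k] LRTensor R T)) : Prop :=
  (∀ w, ∃ Z, EqMulOneTmul X w Z ∧ IsComulMulOneTmul R T HA HB u w Z) ∧
  (∀ w, ∃ Z, EqTmulOneMul w X Z ∧ IsTmulOneMulComul R T HA HB w u Z)

/-- `ε_{RT} = ε_A ⊗ ε_B`. -/
def lrCounit (εA : A →ₗ[k] k) (εB : B →ₗ[k] k) : LRTensor R T →ₗ[k] k :=
  LinearMap.mul' k k ∘ₗ TensorProduct.map εA εB ∘ₗ (hash R T).symm.toLinearMap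

/-- `S_{RT} = T ∘ R ∘ (S_B ⊗ S_A) ∘ τ`. -/
def lrAntipode (SA : A →ₗ[k] A) (SB : B →ₗ[k] B) : LRTensor R T →ₗ[k] LRTensor R T :=
  (hash R T).toLinearMap ∘ₗ T.toLinearMap ∘ₗ R.toLinearMap ∘ₗ TensorProduct.map SB SA ∘ₗ
    (TensorProduct.comm k A B).toLinearMap ∘ₗ (hash R T).symm.toLinearMap

end Twisted

end MultHopf

end

/-!
Write `D` for `A #_{RT} B`. The proof rests on the factorizations `T(a ⊗ b) = (a # 1)(1 # b)` and
`R(b ⊗ a) = (1 # b)(a # 1)` of `D`, here the bijections `mulAB : A ⊗ B ≃ D` and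
`mulBA : B ⊗ A ≃ D`. The one-sided multiplications by `a # 1` and `1 # b` are operators `lamA`,
`lamB`, `rhoA`, `rhoB` on `D`; the twisting conditions say that `mulAB` and `mulBA` intertwine them
with the multiplications of `A` and `B`, and the two mixed conditions say that
`(a # 1)(R(d ⊗ c)) = T(a ⊗ d)(c # 1)` and its mirror image hold. Once `mulAB_mul` identifies `T(a ⊗
b) v` with `lamA a (lamB b v)`, the associativity of `D` follows without further computation.
Moreover `(T * R)(v ⊗ w)` and `(R * T)(w ⊗ v)` are the products `(T R τ v) w` and `w (T R τ v)`
(`hash_TstarR`, `hash_RstarT`), so the first hypothesis is the nondegeneracy of `D`, and the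
hypotheses on the antipodes are the two antipode identities for `S_{RT}`.

The comultiplication is defined by `Δ((1 # b)(a # 1)) = ((1 ⊗ 1) # Δ_B(b)) (Δ_A(a) # (1 ⊗ 1))`
(`lrComul`). By nondegeneracy the formula for `Δ_{RT}` determines a pair of operators
(`IsComul.unique`), so that `Δ((a # 1)(1 # b)) = (Δ_A(a) # (1 ⊗ 1)) ((1 ⊗ 1) # Δ_B(b))` as well,
and `Δ` is multiplicative (`lrComul_mul`). The map `T₁ : b a ⊗ v ↦ b₁ a₁ ⊗ b₂ a₂ v` is composed of
`a ⊗ v ↦ a₁ ⊗ a₂ v` and `b ⊗ v ↦ b₁ ⊗ b₂ v`, which are `T₁` of `A` and of `B` transported by `mulAB`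
and `mulBA`; so it is bijective, and likewise for `T₂`. Coassociativity holds because the pieces of
`T₂` and `T₁` commute, by the coassociativity of `A` and `B` or because they act on different legs
(`LegCommute.compose`).

The formula for `Δ_{RT}` with covered legs gives the counit identities. The multiplicativity of the
counit and the anti-multiplicativity of the antipode follow from these identities and the
bijectivity of `T₁` in any multiplier Hopf algebra. Neither the construction of `T₁`, `T₂` nor the
proof of coassociativity uses the formula for `Δ_{RT}`, so they apply to `τ Δ_A` and `τ Δ_B` and
give regularity.
-/

open scoped TensorProduct

noncomputable section

namespace MultHopf

/-! ### Jointly injective families and tensor products -/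

section JointlyInjective

variable {k V V' W W' ι : Type*} [Field k] [AddCommGroup V] [Module k V] [AddCommGroup V']
  [Module k V'] [AddCommGroup W] [Module k W] [AddCommGroup W'] [Module k W']

/-- Over a field, a jointly injective family of linear maps stays jointly injective after
tensoring on the right: expand in a basis of the right factor. -/
theorem eq_zero_of_rTensor_eq_zero (f : ι → V →ₗ[k] V')
    (hf : ∀ v, (∀ i, f i v = 0) → v = 0) (z : V ⊗[k] W)
    (hz : ∀ i, (f i).rTensor W z = 0) : z = 0 := by
  classical
  let b := Module.Basis.ofVectorSpace k W
  have key : ∀ (i : ι) (z : V ⊗[k] W) j,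
      TensorProduct.equivFinsuppOfBasisRight b ((f i).rTensor W z) j =
        f i (TensorProduct.equivFinsuppOfBasisRight b z j) := by
    intro i z j
    induction z with
    | zero => simp
    | tmul v w => simp
    | add x y hx hy => simp [hx, hy]
  apply (TensorProduct.equivFinsuppOfBasisRight (M := V) b).injective
  ext j
  simp only [map_zero, Finsupp.coe_zero, Pi.zero_apply]
  refine hf _ fun i => ?_
  rw [← key, hz]
  simp

theorem eq_zero_of_lTensor_eq_zero (f : ι → V →ₗ[k] V')
    (hf : ∀ v, (∀ i, f i v = 0) → v = 0) (z : W ⊗[k] V)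
    (hz : ∀ i, (f i).lTensor W z = 0) : z = 0 := by
  apply (TensorProduct.comm k W V).injective
  rw [map_zero]
  refine eq_zero_of_rTensor_eq_zero f hf _ fun i => ?_
  rw [← LinearMap.comm_comp_lTensor_comp_comm_eq]
  simp [hz]

theorem eq_zero_of_map_eq_zero {κ : Type*} (f : ι → V →ₗ[k] V') (g : κ → W →ₗ[k] W')
    (hf : ∀ v, (∀ i, f i v = 0) → v = 0) (hg : ∀ w, (∀ j, g j w = 0) → w = 0) (z : V ⊗[k] W)
    (hz : ∀ i j, TensorProduct.map (f i) (g j) z = 0) : z = 0 := by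
  refine eq_zero_of_lTensor_eq_zero g hg z fun j => ?_
  refine eq_zero_of_rTensor_eq_zero f hf _ fun i => ?_
  rw [← LinearMap.comp_apply, LinearMap.rTensor_comp_lTensor, hz]

end JointlyInjective

/-! ### Multipliers of the tensor square of a nondegenerate algebra -/

section Nondegenerate

variable {k D : Type*} [Field k] [NonUnitalNonAssocRing D] [Module k D]
  [IsScalarTower k D D] [SMulCommClass k D D]

theorem map_mulRight_apply (s t : D) (z : D ⊗[k] D) :
    TensorProduct.map (LinearMap.mulRight k s) (LinearMap.mulRight k t) z = z * (s ⊗ₜ t) := by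
  induction z with
  | zero => simp
  | tmul v w => simp
  | add x y hx hy => rw [map_add, hx, hy, add_mul]

theorem map_mulLeft_apply (s t : D) (z : D ⊗[k] D) :
    TensorProduct.map (LinearMap.mulLeft k s) (LinearMap.mulLeft k t) z = (s ⊗ₜ t) * z := by
  induction z with
  | zero => simp
  | tmul v w => simp
  | add x y hx hy => rw [map_add, hx, hy, mul_add]

theorem tensor_eq_of_mul_right (hl : ∀ a : D, (∀ b : D, a * b = 0) → a = 0) {z z' : D ⊗[k] D}
    (h : ∀ s t : D, z * (s ⊗ₜ t) = z' * (s ⊗ₜ t)) : z = z' := by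
  rw [← sub_eq_zero]
  refine eq_zero_of_map_eq_zero (fun s : D => LinearMap.mulRight k s)
    (fun s : D => LinearMap.mulRight k s) (fun v hv => hl v hv) (fun v hv => hl v hv) _ ?_
  intro s t
  rw [map_mulRight_apply, sub_mul, h, sub_self]

theorem tensor_eq_of_mul_left (hr : ∀ a : D, (∀ b : D, b * a = 0) → a = 0) {z z' : D ⊗[k] D}
    (h : ∀ s t : D, (s ⊗ₜ t) * z = (s ⊗ₜ t) * z') : z = z' := by
  rw [← sub_eq_zero]
  refine eq_zero_of_map_eq_zero (fun s : D => LinearMap.mulLeft k s)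
    (fun s : D => LinearMap.mulLeft k s) (fun v hv => hr v hv) (fun v hv => hr v hv) _ ?_
  intro s t
  rw [map_mulLeft_apply, mul_sub, h, sub_self]

theorem tensor_mul_assoc (ha : ∀ a b c : D, a * b * c = a * (b * c)) (x y z : D ⊗[k] D) :
    x * y * z = x * (y * z) := by
  induction x with
  | zero => simp
  | add x y hx hy => simp only [add_mul, hx, hy]
  | tmul a a' =>
  induction y with
  | zero => simp
  | add x y hx hy => simp only [add_mul, mul_add, hx, hy]
  | tmul b b' =>
  induction z with
  | zero => simp
  | add x y hx hy => simp only [mul_add, hx, hy]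
  | tmul c c' => simp [ha]

theorem lTensor_mulRight_mul (ha : ∀ a b c : D, a * b * c = a * (b * c)) (w : D)
    (x y : D ⊗[k] D) :
    (LinearMap.mulRight k w).lTensor D x * y = x * (LinearMap.mulLeft k w).lTensor D y := by
  induction x with
  | zero => simp
  | add x y hx hy => simp only [map_add, add_mul, hx, hy]
  | tmul a a' =>
  induction y with
  | zero => simp
  | add x y hx hy => simp only [map_add, mul_add, hx, hy]
  | tmul b b' => simp [ha]

theorem rTensor_mulRight_mul (ha : ∀ a b c : D, a * b * c = a * (b * c)) (w : D)
    (x y : D ⊗[k] D) :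
    (LinearMap.mulRight k w).rTensor D x * y = x * (LinearMap.mulLeft k w).rTensor D y := by
  induction x with
  | zero => simp
  | add x y hx hy => simp only [map_add, add_mul, hx, hy]
  | tmul a a' =>
  induction y with
  | zero => simp
  | add x y hx hy => simp only [map_add, mul_add, hx, hy]
  | tmul b b' => simp [ha]

theorem mul'_rTensor_mulLeft (ha : ∀ a b c : D, a * b * c = a * (b * c)) (a : D) (z : D ⊗[k] D) :
    LinearMap.mul' k D ((LinearMap.mulLeft k a).rTensor D z) = a * LinearMap.mul' k D z := by
  induction z with
  | zero => simp
  | add x y hx hy => simp only [map_add, mul_add, hx, hy]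
  | tmul b c => simp [ha]

/-- The left component of a multiplier commutes with right multiplications. -/
theorem Multiplier.apply_mul (ha : ∀ a b c : D, a * b * c = a * (b * c))
    (hr : ∀ a : D, (∀ b : D, b * a = 0) → a = 0) (X : Multiplier k (D ⊗[k] D))
    (x y : D ⊗[k] D) : X.1.1 (x * y) = X.1.1 x * y :=
  tensor_eq_of_mul_left hr fun s t => by
    rw [← X.2, ← tensor_mul_assoc ha, X.2, tensor_mul_assoc ha]

/-- For a multiplier `X` of `D ⊗ D`, the left component of `X (1 ⊗ w) = Z` implies the right one. -/
theorem eqMulOneTmul_of_left (ha : ∀ a b c : D, a * b * c = a * (b * c))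
    (hl : ∀ a : D, (∀ b : D, a * b = 0) → a = 0) (X : Multiplier k (D ⊗[k] D)) (w : D)
    (Z : D ⊗[k] D) (h : ∀ s t : D, X.1.1 (s ⊗ₜ (w * t)) = Z * (s ⊗ₜ t)) :
    EqMulOneTmul (X : EndPair k (D ⊗[k] D)) w Z := by
  have h' : ∀ s : D ⊗[k] D, X.1.1 ((LinearMap.mulLeft k w).lTensor D s) = Z * s := by
    intro s
    induction s with
    | zero => simp
    | add x y hx hy => simp only [map_add, mul_add, hx, hy]
    | tmul s t => simpa using h s t
  refine ⟨h', fun s => tensor_eq_of_mul_right hl fun t t' => ?_⟩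
  rw [lTensor_mulRight_mul ha, X.2 s, h', tensor_mul_assoc ha]

/-- For a multiplier `X` of `D ⊗ D`, the right component of `(w ⊗ 1) X = Z` implies the left one. -/
theorem eqTmulOneMul_of_right (ha : ∀ a b c : D, a * b * c = a * (b * c))
    (hr : ∀ a : D, (∀ b : D, b * a = 0) → a = 0) (X : Multiplier k (D ⊗[k] D)) (w : D)
    (Z : D ⊗[k] D) (h : ∀ s t : D, X.1.2.unop ((s * w) ⊗ₜ t) = (s ⊗ₜ t) * Z) :
    EqTmulOneMul w (X : EndPair k (D ⊗[k] D)) Z := by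
  have h' : ∀ s : D ⊗[k] D, X.1.2.unop ((LinearMap.mulRight k w).rTensor D s) = s * Z := by
    intro s
    induction s with
    | zero => simp
    | add x y hx hy => simp only [map_add, add_mul, hx, hy]
    | tmul s t => simpa using h s t
  refine ⟨fun s => tensor_eq_of_mul_left hr fun t t' => ?_, h'⟩
  rw [← rTensor_mulRight_mul ha, ← X.2, h', tensor_mul_assoc ha]

theorem EqMulOneTmul.unique (hl : ∀ a : D, (∀ b : D, a * b = 0) → a = 0)
    {X : EndPair k (D ⊗[k] D)} {w : D} {Z Z' : D ⊗[k] D} (h : EqMulOneTmul X w Z)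
    (h' : EqMulOneTmul X w Z') : Z = Z' :=
  tensor_eq_of_mul_right hl fun s t => (h.1 (s ⊗ₜ t)).symm.trans (h'.1 (s ⊗ₜ t))

theorem EqTmulOneMul.unique (hr : ∀ a : D, (∀ b : D, b * a = 0) → a = 0)
    {X : EndPair k (D ⊗[k] D)} {w : D} {Z Z' : D ⊗[k] D} (h : EqTmulOneMul w X Z)
    (h' : EqTmulOneMul w X Z') : Z = Z' :=
  tensor_eq_of_mul_left hr fun s t => (h.2 (s ⊗ₜ t)).symm.trans (h'.2 (s ⊗ₜ t))

/-- A pair `X` on `D ⊗ D` is determined by the products `X (1 ⊗ w)` and `(w ⊗ 1) X`: the latter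
give the left component of `X` and the former the right one. -/
theorem EndPair.ext_of_mul (hl : ∀ a : D, (∀ b : D, a * b = 0) → a = 0)
    (hr : ∀ a : D, (∀ b : D, b * a = 0) → a = 0) {X Y : EndPair k (D ⊗[k] D)}
    (h : ∀ w, ∃ Z, EqMulOneTmul X w Z ∧ EqMulOneTmul Y w Z)
    (h' : ∀ w, ∃ Z, EqTmulOneMul w X Z ∧ EqTmulOneMul w Y Z) : X = Y := by
  refine Prod.ext (LinearMap.ext fun s => ?_)
    (MulOpposite.unop_injective (LinearMap.ext fun s => ?_))
  · rw [← sub_eq_zero]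
    refine eq_zero_of_rTensor_eq_zero (fun w : D => LinearMap.mulLeft k w)
      (fun v hv => hr v hv) _ ?_
    intro w
    obtain ⟨Z, h1, h2⟩ := h' w
    rw [map_sub, h1.1, h2.1, sub_self]
  · rw [← sub_eq_zero]
    refine eq_zero_of_lTensor_eq_zero (fun w : D => LinearMap.mulRight k w)
      (fun v hv => hl v hv) _ ?_
    intro w
    obtain ⟨Z, h1, h2⟩ := h w
    rw [map_sub, h1.2, h2.2, sub_self]

end Nondegenerate

/-! ### Counit and antipode of a multiplier Hopf algebra -/

namespace MultiplierHopfAlgebra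

variable {k D : Type*} [Field k] [NonUnitalNonAssocRing D] [Module k D]
  [IsScalarTower k D D] [SMulCommClass k D D] (H : MultiplierHopfAlgebra k D)

theorem comul_apply_tmul_mul (u s w t : D) :
    (H.comul u).1.1 (s ⊗ₜ (w * t)) = H.T₁ (u ⊗ₜ w) * (s ⊗ₜ t) := by
  simpa using (H.T₁_spec u w).1 (s ⊗ₜ t)

theorem comul_apply_T₁ (a : D) (z : D ⊗[k] D) :
    (H.comul a).1.1 (H.T₁ z) = H.T₁ ((LinearMap.mulLeft k a).rTensor D z) := by
  induction z with
  | zero => simp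
  | add x y hx hy => simp only [map_add, hx, hy]
  | tmul b c =>
    refine tensor_eq_of_mul_right H.nondeg_left fun s t => ?_
    rw [← Multiplier.apply_mul H.assoc H.nondeg_right, ← comul_apply_tmul_mul,
      LinearMap.rTensor_tmul, LinearMap.mulLeft_apply, ← comul_apply_tmul_mul, H.comul_mul]
    rfl

/-- A linear form `ε` with `(ε ⊗ id)(Δ(u)(1 ⊗ w)) = u w` is multiplicative. -/
theorem counit_mul (ε : D →ₗ[k] k)
    (hε : ∀ a b : D, TensorProduct.lid k D (ε.rTensor D (H.T₁ (a ⊗ₜ b))) = a * b) (r p : D) :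
    ε (r * p) = ε r * ε p := by
  by_cases hD : ∃ s t : D, s * t ≠ 0
  swap
  · push Not at hD
    have : ∀ a : D, a = 0 := fun a => H.nondeg_left a (hD a)
    rw [this (r * p), this r]
    simp
  obtain ⟨s, t, hst⟩ := hD
  have h1 : ∀ z : D ⊗[k] D, TensorProduct.lid k D (ε.rTensor D (H.T₁ z)) =
      LinearMap.mul' k D z := by
    intro z
    induction z with
    | zero => simp
    | add x y hx hy => simp only [map_add, hx, hy]
    | tmul a b => simpa using hε a b
  -- `(ε ⊗ id)(Δ(a) z) = a (ε ⊗ id)(z)`, as `z` is a sum of terms `Δ(b)(1 ⊗ c)`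
  have h2 : ∀ (a : D) (z : D ⊗[k] D), TensorProduct.lid k D (ε.rTensor D ((H.comul a).1.1 z)) =
      a * TensorProduct.lid k D (ε.rTensor D z) := by
    intro a z
    obtain ⟨z, rfl⟩ := H.T₁.surjective z
    rw [comul_apply_T₁, h1, h1, mul'_rTensor_mulLeft H.assoc]
  have h3 : ∀ z : D ⊗[k] D, TensorProduct.lid k D (ε.rTensor D (H.T₁ z * (p ⊗ₜ t))) =
      ε p • (TensorProduct.lid k D (ε.rTensor D (H.T₁ z)) * t) := by
    intro z
    induction z with
    | zero => simp
    | add x y hx hy => simp only [map_add, add_mul, smul_add, hx, hy]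
    | tmul a q => rw [← comul_apply_tmul_mul, h2, h1]; simp [H.assoc, mul_smul_comm]
  obtain ⟨z, hz⟩ := H.T₁.surjective (r ⊗ₜ s)
  have h4 := h3 z
  rw [hz] at h4
  simp only [Algebra.TensorProduct.tmul_mul_tmul, LinearMap.rTensor_tmul, TensorProduct.lid_tmul,
    smul_mul_assoc, smul_smul] at h4
  rw [mul_comm (ε r)]
  exact smul_left_injective k hst h4

/-- A linear map `S` with `m(S ⊗ id)(Δ(u)(1 ⊗ w)) = ε(u) w` is an anti-homomorphism: it is
determined by `S(u) w = (ε ⊗ id)(T₁⁻¹(u ⊗ w))`. -/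
theorem antipode_mul (ε : D →ₗ[k] k) (hmul : ∀ a b : D, ε (a * b) = ε a * ε b) (S : D →ₗ[k] D)
    (hS : ∀ a b : D, LinearMap.mul' k D (S.rTensor D (H.T₁ (a ⊗ₜ b))) = ε a • b) (a b : D) :
    S (a * b) = S b * S a := by
  have h1 : ∀ z : D ⊗[k] D, LinearMap.mul' k D (S.rTensor D (H.T₁ z)) =
      TensorProduct.lid k D (ε.rTensor D z) := by
    intro z
    induction z with
    | zero => simp
    | add x y hx hy => simp only [map_add, hx, hy]
    | tmul a b => simpa using hS a b
  have h2 : ∀ (a : D) (z : D ⊗[k] D),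
      LinearMap.mul' k D (S.rTensor D ((H.comul a).1.1 z)) =
        ε a • LinearMap.mul' k D (S.rTensor D z) := by
    intro a z
    obtain ⟨z, rfl⟩ := H.T₁.surjective z
    rw [comul_apply_T₁, h1, h1]
    induction z with
    | zero => simp
    | add x y hx hy => simp only [map_add, smul_add, hx, hy]
    | tmul c d => simp [hmul, mul_smul]
  have h3 : ∀ (z : D ⊗[k] D) (t : D), LinearMap.mul' k D (S.rTensor D (H.T₁ z * (b ⊗ₜ t))) =
      S b * (LinearMap.mul' k D (S.rTensor D (H.T₁ z)) * t) := by
    intro z t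
    induction z with
    | zero => simp
    | add x y hx hy => simp only [map_add, add_mul, mul_add, hx, hy]
    | tmul a q => rw [← comul_apply_tmul_mul, h2, hS]; simp [smul_mul_assoc, mul_smul_comm]
  rw [← sub_eq_zero]
  refine H.nondeg_left _ fun c => H.nondeg_left _ fun t => ?_
  obtain ⟨z, hz⟩ := H.T₁.surjective (a ⊗ₜ c)
  have h4 := h3 z t
  rw [hz] at h4
  simp only [Algebra.TensorProduct.tmul_mul_tmul, LinearMap.rTensor_tmul, LinearMap.mul'_apply]
    at h4
  rw [sub_mul, sub_mul, H.assoc, h4, H.assoc, H.assoc, H.assoc, sub_self]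

end MultiplierHopfAlgebra

/-! ### The algebra `A #_{RT} B` and its one-sided multiplication operators -/

section Twisted

variable {k : Type*} {A : Type*} {B : Type*} [Field k]
  [NonUnitalRing A] [Module k A] [IsScalarTower k A A] [SMulCommClass k A A]
  [NonUnitalRing B] [Module k B] [IsScalarTower k B B] [SMulCommClass k B B]
  (R : (B ⊗[k] A) ≃ₗ[k] (A ⊗[k] B)) (T : (A ⊗[k] B) ≃ₗ[k] (A ⊗[k] B))

/-- `a ⊗ b ↦ T(a ⊗ b)`, which is to be read as `(a # 1)(1 # b)`. -/
def mulAB : (A ⊗[k] B) ≃ₗ[k] LRTensor R T := T.trans (hash R T)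

/-- `b ⊗ a ↦ R(b ⊗ a)`, which is to be read as `(1 # b)(a # 1)`. -/
def mulBA : (B ⊗[k] A) ≃ₗ[k] LRTensor R T := R.trans (hash R T)

/-- Left multiplication by `a # 1`: `c # d ↦ a_T c # d_T`. -/
def lamA : A →ₗ[k] LRTensor R T →ₗ[k] LRTensor R T :=
  TensorProduct.curry ((hash R T).toLinearMap ∘ₗ (LinearMap.mul' k A).rTensor B ∘ₗ leg13 T A ∘ₗ
    (TensorProduct.assoc k A A B).symm.toLinearMap ∘ₗ (hash R T).symm.toLinearMap.lTensor A)

/-- Left multiplication by `1 # b`: `c # d ↦ c_R # b_R d`. -/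
def lamB : B →ₗ[k] LRTensor R T →ₗ[k] LRTensor R T :=
  TensorProduct.curry ((hash R T).toLinearMap ∘ₗ (LinearMap.mul' k B).lTensor A ∘ₗ
    (TensorProduct.assoc k A B B).toLinearMap ∘ₗ R.toLinearMap.rTensor B ∘ₗ
    (TensorProduct.assoc k B A B).symm.toLinearMap ∘ₗ (hash R T).symm.toLinearMap.lTensor B)

/-- Right multiplication by `a # 1`: `c # d ↦ c a_R # d_R`. -/
def rhoA : A →ₗ[k] LRTensor R T →ₗ[k] LRTensor R T :=
  (TensorProduct.curry ((hash R T).toLinearMap ∘ₗ (LinearMap.mul' k A).rTensor B ∘ₗ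
    (TensorProduct.assoc k A A B).symm.toLinearMap ∘ₗ R.toLinearMap.lTensor A ∘ₗ
    (TensorProduct.assoc k A B A).toLinearMap ∘ₗ (hash R T).symm.toLinearMap.rTensor A)).flip

/-- Right multiplication by `1 # b`: `c # d ↦ c_T # d b_T`. -/
def rhoB : B →ₗ[k] LRTensor R T →ₗ[k] LRTensor R T :=
  (TensorProduct.curry ((hash R T).toLinearMap ∘ₗ (LinearMap.mul' k B).lTensor A ∘ₗ
    (TensorProduct.assoc k A B B).toLinearMap ∘ₗ leg13 T B ∘ₗ
    (hash R T).symm.toLinearMap.rTensor B)).flip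

variable {R T}

theorem lamA_mulAB (hRT : IsLRTwisting R T) (a c : A) (b : B) :
    lamA R T a (mulAB R T (c ⊗ₜ b)) = mulAB R T ((a * c) ⊗ₜ b) :=
  congrArg (hash R T) (hRT.T_mul_left a c b).symm

theorem rhoB_mulAB (hRT : IsLRTwisting R T) (a : A) (b d : B) :
    rhoB R T d (mulAB R T (a ⊗ₜ b)) = mulAB R T (a ⊗ₜ (b * d)) :=
  congrArg (hash R T) (hRT.T_mul_right a b d).symm

theorem lamB_mulBA (hRT : IsLRTwisting R T) (b d : B) (a : A) :
    lamB R T b (mulBA R T (d ⊗ₜ a)) = mulBA R T ((b * d) ⊗ₜ a) :=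
  congrArg (hash R T) (hRT.R_mul_left b d a).symm

theorem rhoA_mulBA (hRT : IsLRTwisting R T) (b : B) (a c : A) :
    rhoA R T c (mulBA R T (b ⊗ₜ a)) = mulBA R T (b ⊗ₜ (a * c)) :=
  congrArg (hash R T) (hRT.R_mul_right b a c).symm

theorem rhoA_mulAB (hRT : IsLRTwisting R T) (a c : A) (d : B) :
    rhoA R T c (mulAB R T (a ⊗ₜ d)) = lamA R T a (mulBA R T (d ⊗ₜ c)) :=
  congrArg (fun z => hash R T ((LinearMap.mul' k A).rTensor B z)) (hRT.comm_B a c d)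

theorem rhoB_mulBA (hRT : IsLRTwisting R T) (b d : B) (c : A) :
    rhoB R T d (mulBA R T (b ⊗ₜ c)) = lamB R T b (mulAB R T (c ⊗ₜ d)) :=
  congrArg (fun z => hash R T ((LinearMap.mul' k B).lTensor A
    (TensorProduct.assoc k A B B z))) (hRT.comm_A b d c).symm

theorem lamA_hash (a c : A) (d : B) : lamA R T a (hash R T (c ⊗ₜ d)) =
    hash R T ((LinearMap.mulRight k c).rTensor B (T (a ⊗ₜ d))) := by
  change hash R T ((LinearMap.mul' k A).rTensor B ((TensorProduct.rightComm k A B A)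
    (T (a ⊗ₜ d) ⊗ₜ c))) = _
  induction T (a ⊗ₜ d) with
  | zero => simp
  | tmul x y => simp
  | add x y hx hy => simp only [TensorProduct.add_tmul, map_add, hx, hy]

theorem lamB_hash (b : B) (c : A) (d : B) : lamB R T b (hash R T (c ⊗ₜ d)) =
    hash R T ((LinearMap.mulRight k d).lTensor A (R (b ⊗ₜ c))) := by
  change hash R T ((LinearMap.mul' k B).lTensor A ((TensorProduct.assoc k A B B)
    (R (b ⊗ₜ c) ⊗ₜ d))) = _
  induction R (b ⊗ₜ c) with
  | zero => simp
  | tmul x y => simp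
  | add x y hx hy => simp only [TensorProduct.add_tmul, map_add, hx, hy]

theorem rhoA_hash (a c : A) (d : B) : rhoA R T a (hash R T (c ⊗ₜ d)) =
    hash R T ((LinearMap.mulLeft k c).rTensor B (R (d ⊗ₜ a))) := by
  change hash R T ((LinearMap.mul' k A).rTensor B ((TensorProduct.assoc k A A B).symm
    (c ⊗ₜ R (d ⊗ₜ a)))) = _
  induction R (d ⊗ₜ a) with
  | zero => simp
  | tmul x y => simp
  | add x y hx hy => simp only [TensorProduct.tmul_add, map_add, hx, hy]

theorem rhoB_hash (b : B) (c : A) (d : B) : rhoB R T b (hash R T (c ⊗ₜ d)) =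
    hash R T ((LinearMap.mulLeft k d).lTensor A (T (c ⊗ₜ b))) := by
  change hash R T ((LinearMap.mul' k B).lTensor A ((TensorProduct.assoc k A B B)
    ((TensorProduct.rightComm k A B B) (T (c ⊗ₜ b) ⊗ₜ d)))) = _
  induction T (c ⊗ₜ b) with
  | zero => simp
  | tmul x y => simp
  | add x y hx hy => simp only [TensorProduct.add_tmul, map_add, hx, hy]

theorem hash_mul_hash (a c : A) (b d : B) : hash R T (a ⊗ₜ b) * hash R T (c ⊗ₜ d) =
    hash R T (TensorProduct.map (LinearMap.mul' k A) (LinearMap.mul' k B) (leg14 T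
      (leg23 R ((a ⊗ₜ b) ⊗ₜ (c ⊗ₜ d))))) := rfl

/-- `p ⊗ e ⊗ f ↦ p_T e ⊗ f d_T`, so that `(p # q)(c # d)` is the value at `p ⊗ c_R ⊗ q_R`. -/
def mulPre (T : (A ⊗[k] B) ≃ₗ[k] (A ⊗[k] B)) (d : B) : (A ⊗[k] A) ⊗[k] B →ₗ[k] A ⊗[k] B :=
  TensorProduct.map (LinearMap.mul' k A) (LinearMap.mul' k B) ∘ₗ leg14 T ∘ₗ
    (TensorProduct.assoc k (A ⊗[k] A) B B).toLinearMap ∘ₗ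
    (TensorProduct.mk k ((A ⊗[k] A) ⊗[k] B) B).flip d

theorem mulPre_tmul (p e : A) (f d : B) : mulPre T d ((p ⊗ₜ e) ⊗ₜ f) =
    TensorProduct.map (LinearMap.mulRight k e) (LinearMap.mulLeft k f) (T (p ⊗ₜ d)) := by
  change TensorProduct.map (LinearMap.mul' k A) (LinearMap.mul' k B)
    (TensorProduct.assoc k (A ⊗[k] A) B B ((TensorProduct.assoc k A A B).symm.toLinearMap.rTensor B
      (TensorProduct.rightComm k A B (A ⊗[k] B) (T (p ⊗ₜ d) ⊗ₜ (e ⊗ₜ f))))) = _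
  induction T (p ⊗ₜ d) with
  | zero => simp
  | tmul x y => simp
  | add x y hx hy => simp only [TensorProduct.add_tmul, map_add, hx, hy]

theorem hash_mul_hash' (z : A ⊗[k] B) (c : A) (d : B) : hash R T z * hash R T (c ⊗ₜ d) =
    hash R T (mulPre T d ((TensorProduct.assoc k A A B).symm
      (R.toLinearMap.lTensor A (TensorProduct.assoc k A B A (z ⊗ₜ c))))) := by
  induction z with
  | zero => simp
  | add x y hx hy => simp only [map_add, add_mul, TensorProduct.add_tmul, hx, hy]
  | tmul a b =>
    rw [hash_mul_hash]
    change hash R T (TensorProduct.map (LinearMap.mul' k A) (LinearMap.mul' k B) (leg14 T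
      ((TensorProduct.assoc k A A (B ⊗[k] B)).symm
        (a ⊗ₜ (TensorProduct.assoc k A B B (R (b ⊗ₜ c) ⊗ₜ d)))))) = hash R T (mulPre T d
      ((TensorProduct.assoc k A A B).symm (a ⊗ₜ R (b ⊗ₜ c))))
    induction R (b ⊗ₜ c) with
    | zero => simp
    | tmul x y => simp [mulPre]
    | add x y hx hy => simp only [TensorProduct.add_tmul, TensorProduct.tmul_add, map_add, hx, hy]

/-- At `a_T ⊗ e ⊗ f_T` the second copy of `T` in `mulPre` is absorbed by
`T (id ⊗ m_B) = (id ⊗ m_B) T₁₃ T₁₂`: the value is `(a # 1)(e # f d)`. -/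
theorem mulPre_leg13 (hRT : IsLRTwisting R T) (a : A) (d : B) (z : A ⊗[k] B) :
    hash R T (mulPre T d (leg13 T A ((TensorProduct.assoc k A A B).symm (a ⊗ₜ z)))) =
      lamA R T a (hash R T ((LinearMap.mulRight k d).lTensor A z)) := by
  induction z with
  | zero => simp
  | add x y hx hy => simp only [TensorProduct.tmul_add, map_add, hx, hy]
  | tmul e f =>
    rw [LinearMap.lTensor_tmul, LinearMap.mulRight_apply, lamA_hash]
    have h := rhoB_mulAB hRT a f d
    -- `a_T ⊗ (f d)_T = a_{Tt} ⊗ f_T d_t`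
    have h' : T (a ⊗ₜ (f * d)) = (hash R T).symm (rhoB R T d (mulAB R T (a ⊗ₜ f))) := by
      rw [h]; rfl
    rw [h']
    change hash R T (mulPre T d (TensorProduct.rightComm k A B A (T (a ⊗ₜ f) ⊗ₜ e))) =
      hash R T ((LinearMap.mulRight k e).rTensor B ((hash R T).symm
        (rhoB R T d (hash R T (T (a ⊗ₜ f))))))
    induction T (a ⊗ₜ f) with
    | zero => simp
    | add x y hx hy => simp only [TensorProduct.add_tmul, map_add, hx, hy]
    | tmul x y =>
      rw [rhoB_hash, TensorProduct.rightComm_tmul, mulPre_tmul, LinearEquiv.symm_apply_apply,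
        ← LinearMap.comp_apply, LinearMap.rTensor_comp_lTensor]

/-- Left multiplication by `T(a ⊗ b)` is that by `1 # b` followed by that by `a # 1`. The
relation `comm_B` turns `a_T ⊗ c_R ⊗ b_{TR}` into a form to which the multiplicativity of `T`
applies. -/
theorem mulAB_mul (hRT : IsLRTwisting R T) (a : A) (b : B) (v : LRTensor R T) :
    mulAB R T (a ⊗ₜ b) * v = lamA R T a (lamB R T b v) := by
  obtain ⟨v, rfl⟩ := (hash R T).surjective v
  induction v with
  | zero => simp
  | add x y hx hy => simp only [map_add, mul_add, hx, hy]
  | tmul c d =>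
    rw [lamB_hash, ← mulPre_leg13 hRT, ← hRT.comm_B]
    exact hash_mul_hash' _ c d

theorem ext_mulAB {M : Type*} [AddCommGroup M] [Module k M] {f g : LRTensor R T →ₗ[k] M}
    (h : ∀ a b, f (mulAB R T (a ⊗ₜ b)) = g (mulAB R T (a ⊗ₜ b))) : f = g := by
  ext u
  obtain ⟨z, rfl⟩ := (mulAB R T).surjective u
  induction z with
  | zero => simp
  | add x y hx hy => simp only [map_add, hx, hy]
  | tmul a b => exact h a b

theorem ext_mulBA {M : Type*} [AddCommGroup M] [Module k M] {f g : LRTensor R T →ₗ[k] M}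
    (h : ∀ b a, f (mulBA R T (b ⊗ₜ a)) = g (mulBA R T (b ⊗ₜ a))) : f = g := by
  ext u
  obtain ⟨z, rfl⟩ := (mulBA R T).surjective u
  induction z with
  | zero => simp
  | add x y hx hy => simp only [map_add, hx, hy]
  | tmul a b => exact h a b

theorem lamA_mul (hRT : IsLRTwisting R T) (a c : A) (v : LRTensor R T) :
    lamA R T (a * c) v = lamA R T a (lamA R T c v) := by
  suffices lamA R T (a * c) = lamA R T a ∘ₗ lamA R T c from LinearMap.congr_fun this v
  refine ext_mulAB fun x y => ?_
  simp only [LinearMap.comp_apply, lamA_mulAB hRT, mul_assoc]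

theorem lamB_mul (hRT : IsLRTwisting R T) (b d : B) (v : LRTensor R T) :
    lamB R T (b * d) v = lamB R T b (lamB R T d v) := by
  suffices lamB R T (b * d) = lamB R T b ∘ₗ lamB R T d from LinearMap.congr_fun this v
  refine ext_mulBA fun x y => ?_
  simp only [LinearMap.comp_apply, lamB_mulBA hRT, mul_assoc]

theorem lamA_rhoB (hRT : IsLRTwisting R T) (a : A) (b : B) (v : LRTensor R T) :
    lamA R T a (rhoB R T b v) = rhoB R T b (lamA R T a v) := by
  suffices lamA R T a ∘ₗ rhoB R T b = rhoB R T b ∘ₗ lamA R T a from LinearMap.congr_fun this v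
  refine ext_mulAB fun x y => ?_
  simp only [LinearMap.comp_apply, rhoB_mulAB hRT, lamA_mulAB hRT]

theorem lamB_rhoA (hRT : IsLRTwisting R T) (a : A) (b : B) (v : LRTensor R T) :
    lamB R T b (rhoA R T a v) = rhoA R T a (lamB R T b v) := by
  suffices lamB R T b ∘ₗ rhoA R T a = rhoA R T a ∘ₗ lamB R T b from LinearMap.congr_fun this v
  refine ext_mulBA fun x y => ?_
  simp only [LinearMap.comp_apply, rhoA_mulBA hRT, lamB_mulBA hRT]

theorem lamA_rhoA (hRT : IsLRTwisting R T) (a c : A) (v : LRTensor R T) :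
    lamA R T a (rhoA R T c v) = rhoA R T c (lamA R T a v) := by
  suffices lamA R T a ∘ₗ rhoA R T c = rhoA R T c ∘ₗ lamA R T a from LinearMap.congr_fun this v
  refine ext_mulAB fun x y => ?_
  simp only [LinearMap.comp_apply, rhoA_mulAB hRT, lamA_mulAB hRT, lamA_mul hRT]

theorem lamB_rhoB (hRT : IsLRTwisting R T) (b d : B) (v : LRTensor R T) :
    lamB R T b (rhoB R T d v) = rhoB R T d (lamB R T b v) := by
  suffices lamB R T b ∘ₗ rhoB R T d = rhoB R T d ∘ₗ lamB R T b from LinearMap.congr_fun this v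
  refine ext_mulBA fun x y => ?_
  simp only [LinearMap.comp_apply, rhoB_mulBA hRT, lamB_mulBA hRT, lamB_mul hRT]

/-- Checked on the image of `mulAB`, where `rhoA_mulAB` and `rhoB_mulBA` pass from one factorization
to the other. -/
theorem mul_mulAB (hRT : IsLRTwisting R T) (c : A) (d : B) (u : LRTensor R T) :
    u * mulAB R T (c ⊗ₜ d) = rhoB R T d (rhoA R T c u) := by
  suffices LinearMap.mulRight k (mulAB R T (c ⊗ₜ d)) = rhoB R T d ∘ₗ rhoA R T c from
    LinearMap.congr_fun this u
  refine ext_mulAB fun a b => ?_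
  simp only [LinearMap.mulRight_apply, LinearMap.comp_apply, mulAB_mul hRT, rhoA_mulAB hRT]
  rw [← rhoB_mulBA hRT, lamA_rhoB hRT]

theorem mul_mulBA (hRT : IsLRTwisting R T) (c : A) (d : B) (u : LRTensor R T) :
    u * mulBA R T (d ⊗ₜ c) = rhoA R T c (rhoB R T d u) := by
  suffices LinearMap.mulRight k (mulBA R T (d ⊗ₜ c)) = rhoA R T c ∘ₗ rhoB R T d from
    LinearMap.congr_fun this u
  refine ext_mulAB fun a b => ?_
  simp only [LinearMap.mulRight_apply, LinearMap.comp_apply, mulAB_mul hRT, rhoB_mulAB hRT,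
    lamB_mulBA hRT, rhoA_mulAB hRT]

theorem mulBA_mul (hRT : IsLRTwisting R T) (b : B) (a : A) (v : LRTensor R T) :
    mulBA R T (b ⊗ₜ a) * v = lamB R T b (lamA R T a v) := by
  suffices LinearMap.mulLeft k (mulBA R T (b ⊗ₜ a)) = lamB R T b ∘ₗ lamA R T a from
    LinearMap.congr_fun this v
  refine ext_mulAB fun c d => ?_
  simp only [LinearMap.mulLeft_apply, LinearMap.comp_apply, mul_mulAB hRT, rhoA_mulBA hRT,
    lamA_mulAB hRT, rhoB_mulBA hRT]

theorem lamA_mul_assoc (hRT : IsLRTwisting R T) (a : A) (v w : LRTensor R T) :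
    lamA R T a v * w = lamA R T a (v * w) := by
  obtain ⟨w, rfl⟩ := (mulAB R T).surjective w
  induction w with
  | zero => simp
  | add x y hx hy => simp only [map_add, mul_add, hx, hy]
  | tmul c d => simp only [mul_mulAB hRT, lamA_rhoB hRT, lamA_rhoA hRT]

theorem lamB_mul_assoc (hRT : IsLRTwisting R T) (b : B) (v w : LRTensor R T) :
    lamB R T b v * w = lamB R T b (v * w) := by
  obtain ⟨w, rfl⟩ := (mulAB R T).surjective w
  induction w with
  | zero => simp
  | add x y hx hy => simp only [map_add, mul_add, hx, hy]
  | tmul c d => simp only [mul_mulAB hRT, lamB_rhoB hRT, lamB_rhoA hRT]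

theorem lrMul_assoc (hRT : IsLRTwisting R T) (u v w : LRTensor R T) :
    u * v * w = u * (v * w) := by
  obtain ⟨u, rfl⟩ := (mulAB R T).surjective u
  induction u with
  | zero => simp
  | add x y hx hy => simp only [map_add, add_mul, hx, hy]
  | tmul c d => simp only [mulAB_mul hRT, lamA_mul_assoc hRT, lamB_mul_assoc hRT]

/-- `(T * R)(v ⊗ w)` is the product `(T R τ v) w`. -/
theorem hash_TstarR (hRT : IsLRTwisting R T) (v w : A ⊗[k] B) :
    hash R T (TstarR R T (v ⊗ₜ w)) =
      mulAB R T (R (TensorProduct.comm k A B v)) * hash R T w := by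
  induction w with
  | zero => simp
  | add x y hx hy => simp only [map_add, mul_add, TensorProduct.tmul_add, hx, hy]
  | tmul a x =>
    change hash R T ((LinearMap.mul' k A).rTensor B (leg13 T A ((LinearMap.mul' k B).lTensor
      (A ⊗[k] A) (leg23 R (R (TensorProduct.comm k A B v) ⊗ₜ (a ⊗ₜ x)))))) = _
    induction R (TensorProduct.comm k A B v) with
    | zero => simp
    | add x y hx hy => simp only [map_add, add_mul, TensorProduct.add_tmul, hx, hy]
    | tmul p q =>
      rw [mulAB_mul hRT, lamB_hash]
      change hash R T ((LinearMap.mul' k A).rTensor B (leg13 T A ((LinearMap.mul' k B).lTensor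
        (A ⊗[k] A) ((TensorProduct.assoc k A A (B ⊗[k] B)).symm
          (p ⊗ₜ (TensorProduct.assoc k A B B (R (q ⊗ₜ a) ⊗ₜ x))))))) = _
      induction R (q ⊗ₜ a) with
      | zero => simp
      | add x y hx hy => simp only [map_add, TensorProduct.tmul_add, TensorProduct.add_tmul, hx, hy]
      | tmul e f => rfl

/-- `(R * T)(w ⊗ v)` is the product `w (T R τ v)`. -/
theorem hash_RstarT (hRT : IsLRTwisting R T) (w v : A ⊗[k] B) :
    hash R T (RstarT R T (w ⊗ₜ v)) =
      hash R T w * mulAB R T (R (TensorProduct.comm k A B v)) := by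
  induction w with
  | zero => simp
  | add x y hx hy => simp only [map_add, add_mul, TensorProduct.add_tmul, hx, hy]
  | tmul a x =>
    change hash R T ((LinearMap.mul' k B).lTensor A (TensorProduct.assoc k A B B (leg13 T B
      ((TensorProduct.assoc k A B B).symm ((LinearMap.mul' k A).rTensor (B ⊗[k] B)
        (leg23 R ((a ⊗ₜ x) ⊗ₜ R (TensorProduct.comm k A B v)))))))) = _
    induction R (TensorProduct.comm k A B v) with
    | zero => simp
    | add x y hx hy => simp only [map_add, mul_add, TensorProduct.tmul_add, hx, hy]
    | tmul p q =>
      rw [mul_mulAB hRT, rhoA_hash]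
      change hash R T ((LinearMap.mul' k B).lTensor A (TensorProduct.assoc k A B B (leg13 T B
        ((TensorProduct.assoc k A B B).symm ((LinearMap.mul' k A).rTensor (B ⊗[k] B)
          ((TensorProduct.assoc k A A (B ⊗[k] B)).symm
            (a ⊗ₜ (TensorProduct.assoc k A B B (R (x ⊗ₜ p) ⊗ₜ q)))))))) ) = _
      induction R (x ⊗ₜ p) with
      | zero => simp
      | add x y hx hy => simp only [map_add, TensorProduct.tmul_add, TensorProduct.add_tmul, hx, hy]
      | tmul e f => rfl

theorem lr_nondeg_left (hRT : IsLRTwisting R T) (h : ∀ u : A ⊗[k] B,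
      (∀ (a : A) (b : B), TstarR R T (u ⊗ₜ (a ⊗ₜ b)) = 0) → u = 0)
    (u : LRTensor R T) (hu : ∀ v, u * v = 0) : u = 0 := by
  obtain ⟨v, rfl⟩ := ((TensorProduct.comm k A B).trans (R.trans (mulAB R T))).surjective u
  rw [h v, map_zero]
  intro a b
  apply (hash R T).injective
  rw [hash_TstarR hRT, map_zero]
  exact hu _

theorem lr_nondeg_right (hRT : IsLRTwisting R T) (h : ∀ u : A ⊗[k] B,
      (∀ (a : A) (b : B), RstarT R T ((a ⊗ₜ b) ⊗ₜ u) = 0) → u = 0)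
    (u : LRTensor R T) (hu : ∀ v, v * u = 0) : u = 0 := by
  obtain ⟨v, rfl⟩ := ((TensorProduct.comm k A B).trans (R.trans (mulAB R T))).surjective u
  rw [h v, map_zero]
  intro a b
  apply (hash R T).injective
  rw [hash_RstarT hRT, map_zero]
  exact hu _

end Twisted

/-! ### Maps acting on two legs of a tensor product -/

section Legs

variable {k : Type*} [Field k] {E V E' F V' F' W W' A B D D' : Type*}
  [AddCommGroup E] [Module k E] [AddCommGroup V] [Module k V] [AddCommGroup E'] [Module k E']
  [AddCommGroup F] [Module k F] [AddCommGroup V'] [Module k V'] [AddCommGroup F'] [Module k F']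
  [AddCommGroup W] [Module k W] [AddCommGroup W'] [Module k W']
  [AddCommGroup A] [Module k A] [AddCommGroup B] [Module k B]
  [AddCommGroup D] [Module k D] [AddCommGroup D'] [Module k D']

/-- The action `f₁₂` on `E ⊗ (V ⊗ E')` of an automorphism `f` of `E ⊗ V`. -/
def firstTwo (E' : Type*) [AddCommGroup E'] [Module k E'] (f : (E ⊗[k] V) ≃ₗ[k] (E ⊗[k] V)) :
    (E ⊗[k] (V ⊗[k] E')) ≃ₗ[k] (E ⊗[k] (V ⊗[k] E')) :=
  (TensorProduct.assoc k E V E').symm.trans ((f.rTensor E').trans (TensorProduct.assoc k E V E'))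

/-- The action `f₁₃` on `E ⊗ (B ⊗ A)` of an automorphism `f` of `E ⊗ A`. -/
def firstThird (B : Type*) [AddCommGroup B] [Module k B] (f : (E ⊗[k] A) ≃ₗ[k] (E ⊗[k] A)) :
    (E ⊗[k] (B ⊗[k] A)) ≃ₗ[k] (E ⊗[k] (B ⊗[k] A)) :=
  (TensorProduct.assoc k E B A).symm.trans ((TensorProduct.rightComm k E B A).trans
    ((f.rTensor B).trans ((TensorProduct.rightComm k E A B).trans (TensorProduct.assoc k E B A))))

/-- The action `g₂₃` on `(B ⊗ A) ⊗ E` of an automorphism `g` of `A ⊗ E`. -/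
def lastTwo (B : Type*) [AddCommGroup B] [Module k B] (g : (A ⊗[k] E) ≃ₗ[k] (A ⊗[k] E)) :
    ((B ⊗[k] A) ⊗[k] E) ≃ₗ[k] ((B ⊗[k] A) ⊗[k] E) :=
  (TensorProduct.assoc k B A E).trans ((g.lTensor B).trans (TensorProduct.assoc k B A E).symm)

/-- The action `g₁₃` on `(B ⊗ A) ⊗ E` of an automorphism `g` of `B ⊗ E`. -/
def firstLast (A : Type*) [AddCommGroup A] [Module k A] (g : (B ⊗[k] E) ≃ₗ[k] (B ⊗[k] E)) :
    ((B ⊗[k] A) ⊗[k] E) ≃ₗ[k] ((B ⊗[k] A) ⊗[k] E) :=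
  (TensorProduct.assoc k B A E).trans ((TensorProduct.leftComm k B A E).trans
    ((g.lTensor A).trans ((TensorProduct.leftComm k A B E).trans
      (TensorProduct.assoc k B A E).symm)))

theorem firstTwo_tmul (f : (E ⊗[k] V) ≃ₗ[k] (E ⊗[k] V)) (x : E) (y : V) (z : E') :
    firstTwo E' f (x ⊗ₜ (y ⊗ₜ z)) = TensorProduct.assoc k E V E' (f (x ⊗ₜ y) ⊗ₜ z) := rfl

theorem firstThird_tmul (f : (E ⊗[k] A) ≃ₗ[k] (E ⊗[k] A)) (x : E) (b : B) (a : A) :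
    firstThird B f (x ⊗ₜ (b ⊗ₜ a)) = TensorProduct.assoc k E B A
      (TensorProduct.rightComm k E A B (f (x ⊗ₜ a) ⊗ₜ b)) := rfl

theorem lastTwo_tmul (g : (A ⊗[k] E) ≃ₗ[k] (A ⊗[k] E)) (x : E) (b : B) (a : A) :
    lastTwo B g ((b ⊗ₜ a) ⊗ₜ x) = (TensorProduct.assoc k B A E).symm (b ⊗ₜ g (a ⊗ₜ x)) := rfl

theorem firstLast_tmul (g : (B ⊗[k] E) ≃ₗ[k] (B ⊗[k] E)) (x : E) (b : B) (a : A) :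
    firstLast A g ((b ⊗ₜ a) ⊗ₜ x) = (TensorProduct.assoc k B A E).symm
      (TensorProduct.leftComm k A B E (a ⊗ₜ g (b ⊗ₜ x))) := rfl

/-- `f₁₂ g₂₃ = g₂₃ f₁₂` on `E ⊗ V ⊗ E'`. -/
def LegCommute (f : (E ⊗[k] V) ≃ₗ[k] (E ⊗[k] V)) (g : (V ⊗[k] E') ≃ₗ[k] (V ⊗[k] E')) : Prop :=
  ∀ t : E ⊗[k] (V ⊗[k] E'), firstTwo E' f (g.lTensor E t) = g.lTensor E (firstTwo E' f t)

theorem firstTwo_trans (f f' : (E ⊗[k] V) ≃ₗ[k] (E ⊗[k] V)) (t : E ⊗[k] (V ⊗[k] E')) :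
    firstTwo E' (f.trans f') t = firstTwo E' f' (firstTwo E' f t) := by
  change TensorProduct.assoc k E V E' ((f'.toLinearMap ∘ₗ f.toLinearMap).rTensor E'
      ((TensorProduct.assoc k E V E').symm t)) =
    TensorProduct.assoc k E V E' (f'.toLinearMap.rTensor E' ((TensorProduct.assoc k E V E').symm
      (TensorProduct.assoc k E V E' (f.toLinearMap.rTensor E'
        ((TensorProduct.assoc k E V E').symm t)))))
  rw [LinearEquiv.symm_apply_apply, LinearMap.rTensor_comp_apply]

theorem lTensor_trans (g g' : (V ⊗[k] E') ≃ₗ[k] (V ⊗[k] E')) (t : E ⊗[k] (V ⊗[k] E')) :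
    (g.trans g').lTensor E t = g'.lTensor E (g.lTensor E t) :=
  LinearMap.lTensor_comp_apply E g'.toLinearMap g.toLinearMap t

theorem LegCommute.trans_left {f f' : (E ⊗[k] V) ≃ₗ[k] (E ⊗[k] V)}
    {g : (V ⊗[k] E') ≃ₗ[k] (V ⊗[k] E')} (h : LegCommute f g) (h' : LegCommute f' g) :
    LegCommute (f.trans f') g := fun t => by
  rw [firstTwo_trans, firstTwo_trans, h, h']

theorem LegCommute.trans_right {f : (E ⊗[k] V) ≃ₗ[k] (E ⊗[k] V)}
    {g g' : (V ⊗[k] E') ≃ₗ[k] (V ⊗[k] E')} (h : LegCommute f g) (h' : LegCommute f g') :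
    LegCommute f (g.trans g') := fun t => by
  rw [lTensor_trans, lTensor_trans, h', h]

/-- Intertwiners transport the relation `f₁₂ g₂₃ = g₂₃ f₁₂`. -/
theorem LegCommute.apply_map {f : (E ⊗[k] V) ≃ₗ[k] (E ⊗[k] V)}
    {g : (V ⊗[k] E') ≃ₗ[k] (V ⊗[k] E')} (h : LegCommute f g)
    {f' : (F ⊗[k] V') ≃ₗ[k] (F ⊗[k] V')} {g' : (V' ⊗[k] F') ≃ₗ[k] (V' ⊗[k] F')}
    (j : E →ₗ[k] F) (i : V →ₗ[k] V') (j' : E' →ₗ[k] F')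
    (hf : ∀ x y, f' (j x ⊗ₜ i y) = TensorProduct.map j i (f (x ⊗ₜ y)))
    (hg : ∀ y z, g' (i y ⊗ₜ j' z) = TensorProduct.map i j' (g (y ⊗ₜ z)))
    (t : E ⊗[k] (V ⊗[k] E')) :
    firstTwo F' f' (g'.lTensor F (TensorProduct.map j (TensorProduct.map i j') t)) =
      g'.lTensor F (firstTwo F' f' (TensorProduct.map j (TensorProduct.map i j') t)) := by
  have h1 : ∀ t, firstTwo F' f' (TensorProduct.map j (TensorProduct.map i j') t) =
      TensorProduct.map j (TensorProduct.map i j') (firstTwo E' f t) := by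
    intro t
    induction t with
    | zero => simp
    | add x y hx hy => simp only [map_add, hx, hy]
    | tmul x t =>
    induction t with
    | zero => simp
    | add x y hx hy => simp only [map_add, TensorProduct.tmul_add, hx, hy]
    | tmul y z =>
      rw [TensorProduct.map_tmul, TensorProduct.map_tmul, firstTwo_tmul, firstTwo_tmul, hf]
      induction f (x ⊗ₜ y) with
      | zero => simp
      | add x y hx hy => simp only [map_add, TensorProduct.add_tmul, hx, hy]
      | tmul x y => simp
  have h2 : ∀ t, g'.lTensor F (TensorProduct.map j (TensorProduct.map i j') t) =
      TensorProduct.map j (TensorProduct.map i j') (g.lTensor E t) := by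
    intro t
    induction t with
    | zero => simp
    | add x y hx hy => simp only [map_add, hx, hy]
    | tmul x t =>
    induction t with
    | zero => simp
    | add x y hx hy =>
      simp only [map_add, TensorProduct.tmul_add] at hx hy ⊢
      rw [hx, hy]
    | tmul y z =>
      change j x ⊗ₜ g' (i y ⊗ₜ j' z) = j x ⊗ₜ TensorProduct.map i j' (g (y ⊗ₜ z))
      rw [hg]
  rw [h2, h1, h1, h2, h]

theorem LegCommute.firstTwo_firstLast {f : (E ⊗[k] B) ≃ₗ[k] (E ⊗[k] B)}
    {g : (B ⊗[k] E') ≃ₗ[k] (B ⊗[k] E')} (h : LegCommute f g) :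
    LegCommute (firstTwo A f) (firstLast A g) := by
  intro t
  induction t with
  | zero => simp
  | add x y hx hy => simp only [map_add, hx, hy]
  | tmul x t =>
  induction t with
  | zero => simp
  | add x y hx hy => simp only [map_add, TensorProduct.tmul_add, hx, hy]
  | tmul t z =>
  induction t with
  | zero => simp
  | add x y hx hy => simp only [map_add, TensorProduct.tmul_add, TensorProduct.add_tmul, hx, hy]
  | tmul b a =>
    refine h.apply_map (LinearMap.id) ((TensorProduct.mk k B A).flip a) LinearMap.id ?_ ?_
      (x ⊗ₜ (b ⊗ₜ z))
    · intro x y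
      change TensorProduct.assoc k E B A (f (x ⊗ₜ y) ⊗ₜ a) = _
      induction f (x ⊗ₜ y) with
      | zero => simp
      | add x y hx hy => simp only [map_add, TensorProduct.add_tmul, hx, hy]
      | tmul x y => simp
    · intro y z
      change (TensorProduct.assoc k B A E').symm
        (TensorProduct.leftComm k A B E' (a ⊗ₜ g (y ⊗ₜ z))) = _
      induction g (y ⊗ₜ z) with
      | zero => simp
      | add x y hx hy => simp only [map_add, TensorProduct.tmul_add, hx, hy]
      | tmul x y => simp

theorem LegCommute.firstThird_lastTwo {f : (E ⊗[k] A) ≃ₗ[k] (E ⊗[k] A)}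
    {g : (A ⊗[k] E') ≃ₗ[k] (A ⊗[k] E')} (h : LegCommute f g) :
    LegCommute (firstThird B f) (lastTwo B g) := by
  intro t
  induction t with
  | zero => simp
  | add x y hx hy => simp only [map_add, hx, hy]
  | tmul x t =>
  induction t with
  | zero => simp
  | add x y hx hy => simp only [map_add, TensorProduct.tmul_add, hx, hy]
  | tmul t z =>
  induction t with
  | zero => simp
  | add x y hx hy => simp only [map_add, TensorProduct.tmul_add, TensorProduct.add_tmul, hx, hy]
  | tmul b a =>
    refine h.apply_map (LinearMap.id) (TensorProduct.mk k B A b) LinearMap.id ?_ ?_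
      (x ⊗ₜ (a ⊗ₜ z))
    · intro x y
      change TensorProduct.assoc k E B A (TensorProduct.rightComm k E A B (f (x ⊗ₜ y) ⊗ₜ b)) = _
      induction f (x ⊗ₜ y) with
      | zero => simp
      | add x y hx hy => simp only [map_add, TensorProduct.add_tmul, hx, hy]
      | tmul x y => simp
    · intro y z
      change (TensorProduct.assoc k B A E').symm (b ⊗ₜ g (y ⊗ₜ z)) = _
      induction g (y ⊗ₜ z) with
      | zero => simp
      | add x y hx hy => simp only [map_add, TensorProduct.tmul_add, hx, hy]
      | tmul x y => simp

theorem legCommute_firstTwo_lastTwo (f : (E ⊗[k] B) ≃ₗ[k] (E ⊗[k] B))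
    (g : (A ⊗[k] E') ≃ₗ[k] (A ⊗[k] E')) : LegCommute (firstTwo A f) (lastTwo B g) := by
  -- `K` identifies the legs `E ⊗ B` and `A ⊗ E'` on which `f` and `g` act
  let K : ((E ⊗[k] B) ⊗[k] (A ⊗[k] E')) ≃ₗ[k] (E ⊗[k] ((B ⊗[k] A) ⊗[k] E')) :=
    (TensorProduct.assoc k E B (A ⊗[k] E')).trans
      ((TensorProduct.assoc k B A E').symm.lTensor E)
  have hK : ∀ x b a z, K ((x ⊗ₜ b) ⊗ₜ (a ⊗ₜ z)) = x ⊗ₜ ((b ⊗ₜ a) ⊗ₜ z) := fun _ _ _ _ => rfl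
  have h1 : ∀ s t, firstTwo E' (firstTwo A f) (K (s ⊗ₜ t)) = K (f s ⊗ₜ t) := by
    intro s t
    induction s with
    | zero => simp
    | add x y hx hy => simp only [map_add, TensorProduct.add_tmul, hx, hy]
    | tmul x b =>
    induction t with
    | zero => simp
    | add x y hx hy => simp only [map_add, TensorProduct.tmul_add, hx, hy]
    | tmul a z =>
      rw [hK, firstTwo_tmul, firstTwo_tmul]
      induction f (x ⊗ₜ b) with
      | zero => simp
      | add x y hx hy => simp only [map_add, TensorProduct.add_tmul, hx, hy]
      | tmul x y => rfl
  have h2 : ∀ s t, (lastTwo B g).lTensor E (K (s ⊗ₜ t)) = K (s ⊗ₜ g t) := by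
    intro s t
    induction s with
    | zero => simp
    | add x y hx hy => simp only [map_add, TensorProduct.add_tmul, hx, hy]
    | tmul x b =>
    induction t with
    | zero => simp
    | add x y hx hy => simp only [map_add, TensorProduct.tmul_add, hx, hy]
    | tmul a z =>
      change x ⊗ₜ (TensorProduct.assoc k B A E').symm (b ⊗ₜ g (a ⊗ₜ z)) = _
      induction g (a ⊗ₜ z) with
      | zero => simp
      | add x y hx hy => simp only [map_add, TensorProduct.tmul_add, hx, hy]
      | tmul x y => rfl
  intro t
  obtain ⟨t, rfl⟩ := K.surjective t
  induction t with
  | zero => simp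
  | add x y hx hy => simp only [map_add, hx, hy]
  | tmul s t => rw [h2, h1, h1, h2]

theorem legCommute_firstThird_firstLast (f : (E ⊗[k] A) ≃ₗ[k] (E ⊗[k] A))
    (g : (B ⊗[k] E') ≃ₗ[k] (B ⊗[k] E')) : LegCommute (firstThird B f) (firstLast A g) := by
  -- `K` identifies the legs `E ⊗ A` and `B ⊗ E'` on which `f` and `g` act
  let K : ((E ⊗[k] A) ⊗[k] (B ⊗[k] E')) ≃ₗ[k] (E ⊗[k] ((B ⊗[k] A) ⊗[k] E')) :=
    (TensorProduct.assoc k E A (B ⊗[k] E')).trans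
      (((TensorProduct.leftComm k A B E').trans
        (TensorProduct.assoc k B A E').symm).lTensor E)
  have hK : ∀ x b a z, K ((x ⊗ₜ a) ⊗ₜ (b ⊗ₜ z)) = x ⊗ₜ ((b ⊗ₜ a) ⊗ₜ z) := fun _ _ _ _ => rfl
  have h1 : ∀ s t, firstTwo E' (firstThird B f) (K (s ⊗ₜ t)) = K (f s ⊗ₜ t) := by
    intro s t
    induction s with
    | zero => simp
    | add x y hx hy => simp only [map_add, TensorProduct.add_tmul, hx, hy]
    | tmul x b =>
    induction t with
    | zero => simp
    | add x y hx hy => simp only [map_add, TensorProduct.tmul_add, hx, hy]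
    | tmul a z =>
      rw [hK, firstTwo_tmul, firstThird_tmul]
      induction f (x ⊗ₜ b) with
      | zero => simp
      | add x y hx hy => simp only [map_add, TensorProduct.add_tmul, hx, hy]
      | tmul x y => rfl
  have h2 : ∀ s t, (firstLast A g).lTensor E (K (s ⊗ₜ t)) = K (s ⊗ₜ g t) := by
    intro s t
    induction s with
    | zero => simp
    | add x y hx hy => simp only [map_add, TensorProduct.add_tmul, hx, hy]
    | tmul x b =>
    induction t with
    | zero => simp
    | add x y hx hy => simp only [map_add, TensorProduct.tmul_add, hx, hy]
    | tmul a z =>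
      change x ⊗ₜ (TensorProduct.assoc k B A E').symm (TensorProduct.leftComm k A B E'
        (b ⊗ₜ g (a ⊗ₜ z))) = _
      induction g (a ⊗ₜ z) with
      | zero => simp
      | add x y hx hy => simp only [map_add, TensorProduct.tmul_add, hx, hy]
      | tmul x y => rfl
  intro t
  obtain ⟨t, rfl⟩ := K.surjective t
  induction t with
  | zero => simp
  | add x y hx hy => simp only [map_add, hx, hy]
  | tmul s t => rw [h2, h1, h1, h2]

/-- For `g : v ⊗ v' ↦ v₁ ⊗ v₂ v'` and a factorization `e : V' ⊗ W ≃ D`, this is the map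
`v ⊗ d ↦ v₁ ⊗ v₂ d` of `V ⊗ D`. -/
def extendRight (g : (V ⊗[k] V') ≃ₗ[k] (V ⊗[k] V')) (e : (V' ⊗[k] W) ≃ₗ[k] D) :
    (V ⊗[k] D) ≃ₗ[k] (V ⊗[k] D) :=
  (e.symm.lTensor V).trans ((firstTwo W g).trans (e.lTensor V))

/-- For `f : v' ⊗ v ↦ v' v₁ ⊗ v₂` and a factorization `e : W ⊗ V' ≃ D`, this is the map
`d ⊗ v ↦ d v₁ ⊗ v₂` of `D ⊗ V`. -/
def extendLeft (f : (V' ⊗[k] V) ≃ₗ[k] (V' ⊗[k] V)) (e : (W ⊗[k] V') ≃ₗ[k] D) :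
    (D ⊗[k] V) ≃ₗ[k] (D ⊗[k] V) :=
  (e.symm.rTensor V).trans ((lastTwo W f).trans (e.rTensor V))

theorem extendRight_tmul (g : (V ⊗[k] V') ≃ₗ[k] (V ⊗[k] V')) (e : (V' ⊗[k] W) ≃ₗ[k] D)
    (v : V) (v' : V') (w : W) : extendRight g e (v ⊗ₜ e (v' ⊗ₜ w)) =
      TensorProduct.map LinearMap.id (e.toLinearMap ∘ₗ (TensorProduct.mk k V' W).flip w)
        (g (v ⊗ₜ v')) := by
  change (e.lTensor V) (firstTwo W g (v ⊗ₜ e.symm (e (v' ⊗ₜ w)))) = _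
  rw [LinearEquiv.symm_apply_apply, firstTwo_tmul]
  induction g (v ⊗ₜ v') with
  | zero => simp
  | add x y hx hy => simp only [map_add, TensorProduct.add_tmul, hx, hy]
  | tmul x y => rfl

theorem extendLeft_tmul (f : (V' ⊗[k] V) ≃ₗ[k] (V' ⊗[k] V)) (e : (W ⊗[k] V') ≃ₗ[k] D)
    (v : V) (v' : V') (w : W) : extendLeft f e (e (w ⊗ₜ v') ⊗ₜ v) =
      TensorProduct.map (e.toLinearMap ∘ₗ TensorProduct.mk k W V' w) LinearMap.id
        (f (v' ⊗ₜ v)) := by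
  change (e.rTensor V) (lastTwo W f (e.symm (e (w ⊗ₜ v')) ⊗ₜ v)) = _
  rw [LinearEquiv.symm_apply_apply, lastTwo_tmul]
  induction f (v' ⊗ₜ v) with
  | zero => simp
  | add x y hx hy => simp only [map_add, TensorProduct.tmul_add, hx, hy]
  | tmul x y => rfl

theorem LegCommute.extend {f : (E ⊗[k] V) ≃ₗ[k] (E ⊗[k] V)}
    {g : (V ⊗[k] E') ≃ₗ[k] (V ⊗[k] E')} (h : LegCommute f g) (e : (W ⊗[k] E) ≃ₗ[k] D)
    (e' : (E' ⊗[k] W') ≃ₗ[k] D') : LegCommute (extendLeft f e) (extendRight g e') := by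
  intro t
  induction t with
  | zero => simp
  | add x y hx hy => simp only [map_add, hx, hy]
  | tmul x t =>
  induction t with
  | zero => simp
  | add x y hx hy => simp only [map_add, TensorProduct.tmul_add, hx, hy]
  | tmul v z =>
  obtain ⟨x, rfl⟩ := e.surjective x
  obtain ⟨z, rfl⟩ := e'.surjective z
  induction x with
  | zero => simp
  | add x y hx hy => simp only [map_add, TensorProduct.add_tmul, hx, hy]
  | tmul w x =>
  induction z with
  | zero => simp
  | add x y hx hy => simp only [map_add, TensorProduct.tmul_add, hx, hy]
  | tmul z w' =>
    exact h.apply_map (e.toLinearMap ∘ₗ TensorProduct.mk k W E w) LinearMap.id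
      (e'.toLinearMap ∘ₗ (TensorProduct.mk k E' W').flip w')
      (fun x y => extendLeft_tmul f e y x w) (fun y z => extendRight_tmul g e' y z w')
      (x ⊗ₜ (v ⊗ₜ z))

/-- For a factorization `e : B ⊗ A ≃ D` and for `gA : a ⊗ x ↦ a₁ ⊗ a₂ x`, `gB : b ⊗ x ↦ b₁ ⊗ b₂ x`,
this is the map `b a ⊗ x ↦ b₁ a₁ ⊗ b₂ a₂ x`. -/
def composeRight (e : (B ⊗[k] A) ≃ₗ[k] D) (gA : (A ⊗[k] E) ≃ₗ[k] (A ⊗[k] E))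
    (gB : (B ⊗[k] E) ≃ₗ[k] (B ⊗[k] E)) : (D ⊗[k] E) ≃ₗ[k] (D ⊗[k] E) :=
  (e.symm.rTensor E).trans (((lastTwo B gA).trans (firstLast A gB)).trans (e.rTensor E))

/-- For a factorization `e : B ⊗ A ≃ D` and for `fA : x ⊗ a ↦ x a₁ ⊗ a₂`, `fB : x ⊗ b ↦ x b₁ ⊗ b₂`,
this is the map `x ⊗ b a ↦ x b₁ a₁ ⊗ b₂ a₂`. -/
def composeLeft (e : (B ⊗[k] A) ≃ₗ[k] D) (fA : (E ⊗[k] A) ≃ₗ[k] (E ⊗[k] A))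
    (fB : (E ⊗[k] B) ≃ₗ[k] (E ⊗[k] B)) : (E ⊗[k] D) ≃ₗ[k] (E ⊗[k] D) :=
  (e.symm.lTensor E).trans (((firstTwo A fB).trans (firstThird B fA)).trans (e.lTensor E))

theorem composeRight_tmul (e : (B ⊗[k] A) ≃ₗ[k] D) (gA : (A ⊗[k] E) ≃ₗ[k] (A ⊗[k] E))
    (gB : (B ⊗[k] E) ≃ₗ[k] (B ⊗[k] E)) (t : B ⊗[k] A) (x : E) :
    composeRight e gA gB (e t ⊗ₜ x) =
      e.rTensor E (firstLast A gB (lastTwo B gA (t ⊗ₜ x))) := by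
  change e.rTensor E (firstLast A gB (lastTwo B gA (e.symm (e t) ⊗ₜ x))) = _
  rw [LinearEquiv.symm_apply_apply]

theorem composeLeft_tmul (e : (B ⊗[k] A) ≃ₗ[k] D) (fA : (E ⊗[k] A) ≃ₗ[k] (E ⊗[k] A))
    (fB : (E ⊗[k] B) ≃ₗ[k] (E ⊗[k] B)) (t : B ⊗[k] A) (x : E) :
    composeLeft e fA fB (x ⊗ₜ e t) =
      e.lTensor E (firstThird B fA (firstTwo A fB (x ⊗ₜ t))) := by
  change e.lTensor E (firstThird B fA (firstTwo A fB (x ⊗ₜ e.symm (e t)))) = _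
  rw [LinearEquiv.symm_apply_apply]

theorem LegCommute.compose {fA : (E ⊗[k] A) ≃ₗ[k] (E ⊗[k] A)} {fB : (E ⊗[k] B) ≃ₗ[k] (E ⊗[k] B)}
    {gA : (A ⊗[k] E') ≃ₗ[k] (A ⊗[k] E')} {gB : (B ⊗[k] E') ≃ₗ[k] (B ⊗[k] E')}
    (hA : LegCommute fA gA) (hB : LegCommute fB gB) (e : (B ⊗[k] A) ≃ₗ[k] D) :
    LegCommute (composeLeft e fA fB) (composeRight e gA gB) := by
  have h : LegCommute ((firstTwo A fB).trans (firstThird B fA))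
      ((lastTwo B gA).trans (firstLast A gB)) :=
    ((legCommute_firstTwo_lastTwo fB gA).trans_right hB.firstTwo_firstLast).trans_left
      (hA.firstThird_lastTwo.trans_right (legCommute_firstThird_firstLast fA gB))
  intro t
  have ht : t = TensorProduct.map LinearMap.id (TensorProduct.map e.toLinearMap LinearMap.id)
      (TensorProduct.map LinearMap.id (TensorProduct.map e.symm.toLinearMap LinearMap.id) t) := by
    rw [← LinearMap.comp_apply, ← TensorProduct.map_comp, ← TensorProduct.map_comp]
    simp
  rw [ht]
  exact h.apply_map LinearMap.id e.toLinearMap LinearMap.id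
    (fun x y => composeLeft_tmul e fA fB y x) (fun y z => composeRight_tmul e gA gB y z) _

theorem legCommute_iff {f g : (D ⊗[k] D) ≃ₗ[k] (D ⊗[k] D)} : LegCommute f g ↔
    ∀ t : (D ⊗[k] D) ⊗[k] D,
      TensorProduct.assoc k D D D (f.toLinearMap.rTensor D ((TensorProduct.assoc k D D D).symm
        (g.toLinearMap.lTensor D (TensorProduct.assoc k D D D t)))) =
      g.toLinearMap.lTensor D (TensorProduct.assoc k D D D (f.toLinearMap.rTensor D t)) := by
  constructor
  · intro h t
    have h1 : _ = g.toLinearMap.lTensor D (TensorProduct.assoc k D D D (f.toLinearMap.rTensor D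
      ((TensorProduct.assoc k D D D).symm (TensorProduct.assoc k D D D t)))) :=
      h (TensorProduct.assoc k D D D t)
    rw [LinearEquiv.symm_apply_apply] at h1
    exact h1
  · intro h t
    have h1 := h ((TensorProduct.assoc k D D D).symm t)
    rw [LinearEquiv.apply_symm_apply] at h1
    exact h1

end Legs

/-! ### The comultiplication as a map into the multiplier algebra -/

section Comul

variable {k : Type*} {A : Type*} {B : Type*} [Field k]
  [NonUnitalRing A] [Module k A] [IsScalarTower k A A] [SMulCommClass k A A]
  [NonUnitalRing B] [Module k B] [IsScalarTower k B B] [SMulCommClass k B B]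
  {R : (B ⊗[k] A) ≃ₗ[k] (A ⊗[k] B)} {T : (A ⊗[k] B) ≃ₗ[k] (A ⊗[k] B)}

theorem legsT_tmul (a a' : A) (b b' : B) : legsT R T ((a ⊗ₜ a') ⊗ₜ (b ⊗ₜ b')) =
    mulAB R T (a ⊗ₜ b) ⊗ₜ mulAB R T (a' ⊗ₜ b') := rfl

theorem legsR_tmul (a a' : A) (b b' : B) : legsR R T ((b ⊗ₜ b') ⊗ₜ (a ⊗ₜ a')) =
    mulBA R T (b ⊗ₜ a) ⊗ₜ mulBA R T (b' ⊗ₜ a') := rfl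

theorem hashA_left_legsT (M : Multiplier k (A ⊗[k] A)) (s : A ⊗[k] A) (t : B ⊗[k] B) :
    (hashA R T M).1 (legsT R T (s ⊗ₜ t)) = legsT R T (M.1.1 s ⊗ₜ t) := by
  rw [hashA, LinearMap.comp_apply, LinearMap.comp_apply, LinearEquiv.coe_coe, LinearEquiv.coe_coe,
    LinearEquiv.symm_apply_apply, LinearMap.rTensor_tmul]

theorem hashA_right_legsR (M : Multiplier k (A ⊗[k] A)) (s : A ⊗[k] A) (t : B ⊗[k] B) :
    (hashA R T M).2.unop (legsR R T (t ⊗ₜ s)) = legsR R T (t ⊗ₜ M.1.2.unop s) := by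
  rw [hashA, MulOpposite.unop_op, LinearMap.comp_apply, LinearMap.comp_apply, LinearEquiv.coe_coe,
    LinearEquiv.coe_coe, LinearEquiv.symm_apply_apply, LinearMap.lTensor_tmul]

theorem hashB_left_legsR (N : Multiplier k (B ⊗[k] B)) (s : A ⊗[k] A) (t : B ⊗[k] B) :
    (hashB R T N).1 (legsR R T (t ⊗ₜ s)) = legsR R T (N.1.1 t ⊗ₜ s) := by
  rw [hashB, LinearMap.comp_apply, LinearMap.comp_apply, LinearEquiv.coe_coe, LinearEquiv.coe_coe,
    LinearEquiv.symm_apply_apply, LinearMap.rTensor_tmul]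

theorem hashB_right_legsT (N : Multiplier k (B ⊗[k] B)) (s : A ⊗[k] A) (t : B ⊗[k] B) :
    (hashB R T N).2.unop (legsT R T (s ⊗ₜ t)) = legsT R T (s ⊗ₜ N.1.2.unop t) := by
  rw [hashB, MulOpposite.unop_op, LinearMap.comp_apply, LinearMap.comp_apply, LinearEquiv.coe_coe,
    LinearEquiv.coe_coe, LinearEquiv.symm_apply_apply, LinearMap.lTensor_tmul]

theorem endPair_ext_legs {X Y : EndPair k (LRTensor R T ⊗[k] LRTensor R T)}
    {U U' V V' : Type*} [AddCommGroup U] [Module k U] [AddCommGroup U'] [Module k U']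
    [AddCommGroup V] [Module k V] [AddCommGroup V'] [Module k V']
    (e : (U ⊗[k] V) ≃ₗ[k] (LRTensor R T ⊗[k] LRTensor R T))
    (e' : (U' ⊗[k] V') ≃ₗ[k] (LRTensor R T ⊗[k] LRTensor R T))
    (h : ∀ s t, X.1 (e (s ⊗ₜ t)) = Y.1 (e (s ⊗ₜ t)))
    (h' : ∀ s t, X.2.unop (e' (s ⊗ₜ t)) = Y.2.unop (e' (s ⊗ₜ t))) : X = Y := by
  refine Prod.ext (LinearMap.ext fun z => ?_)
    (MulOpposite.unop_injective (LinearMap.ext fun z => ?_))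
  · obtain ⟨z, rfl⟩ := e.surjective z
    induction z with
    | zero => simp
    | add x y hx hy => simp only [map_add, hx, hy]
    | tmul s t => exact h s t
  · obtain ⟨z, rfl⟩ := e'.surjective z
    induction z with
    | zero => simp
    | add x y hx hy => simp only [map_add, hx, hy]
    | tmul s t => exact h' s t

/-- `(1 # b)(a # 1) (a' # 1)(1 # b')` depends on `a` and `a'` only through the product `a a'`. -/
theorem legsR_mul_legsT (hRT : IsLRTwisting R T) (s s' : A ⊗[k] A) (b c b' c' : B) :
    legsR R T ((b ⊗ₜ c) ⊗ₜ s) * legsT R T (s' ⊗ₜ (b' ⊗ₜ c')) =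
      TensorProduct.map
        (rhoB R T b' ∘ₗ (mulBA R T).toLinearMap ∘ₗ TensorProduct.mk k B A b)
        (rhoB R T c' ∘ₗ (mulBA R T).toLinearMap ∘ₗ TensorProduct.mk k B A c) (s * s') := by
  induction s with
  | zero => simp
  | add x y hx hy => simp only [map_add, add_mul, TensorProduct.tmul_add, hx, hy]
  | tmul a a₂ =>
  induction s' with
  | zero => simp
  | add x y hx hy => simp only [map_add, mul_add, TensorProduct.add_tmul, hx, hy]
  | tmul a' a₂' =>
    simp [legsR_tmul, legsT_tmul, mul_mulAB hRT, rhoA_mulBA hRT]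

/-- `(a # 1)(1 # b) (1 # b')(a' # 1)` depends on `b` and `b'` only through the product `b b'`. -/
theorem legsT_mul_legsR (hRT : IsLRTwisting R T) (s s' : B ⊗[k] B) (a c a' c' : A) :
    legsT R T ((a ⊗ₜ c) ⊗ₜ s) * legsR R T (s' ⊗ₜ (a' ⊗ₜ c')) =
      TensorProduct.map
        (rhoA R T a' ∘ₗ (mulAB R T).toLinearMap ∘ₗ TensorProduct.mk k A B a)
        (rhoA R T c' ∘ₗ (mulAB R T).toLinearMap ∘ₗ TensorProduct.mk k A B c) (s * s') := by
  induction s with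
  | zero => simp
  | add x y hx hy => simp only [map_add, add_mul, TensorProduct.tmul_add, hx, hy]
  | tmul b b₂ =>
  induction s' with
  | zero => simp
  | add x y hx hy => simp only [map_add, mul_add, TensorProduct.add_tmul, hx, hy]
  | tmul b' b₂' =>
    simp [legsR_tmul, legsT_tmul, mul_mulBA hRT, rhoB_mulAB hRT]

theorem hashA_mem (hRT : IsLRTwisting R T) (M : Multiplier k (A ⊗[k] A)) :
    hashA R T M ∈ Multiplier k (LRTensor R T ⊗[k] LRTensor R T) := by
  intro x y
  obtain ⟨x, rfl⟩ := (legsR R T).surjective x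
  obtain ⟨y, rfl⟩ := (legsT R T).surjective y
  induction x with
  | zero => simp
  | add x y hx hy => simp only [map_add, add_mul, hx, hy]
  | tmul t s =>
  induction y with
  | zero => simp
  | add x y hx hy => simp only [map_add, mul_add, hx, hy]
  | tmul s' t' =>
  rw [hashA_right_legsR, hashA_left_legsT]
  induction t with
  | zero => simp
  | add x y hx hy => simp only [TensorProduct.add_tmul, map_add, add_mul, hx, hy]
  | tmul b c =>
  induction t' with
  | zero => simp
  | add x y hx hy => simp only [TensorProduct.tmul_add, map_add, mul_add, hx, hy]
  | tmul b' c' => rw [legsR_mul_legsT hRT, legsR_mul_legsT hRT, M.2 s s']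

theorem hashB_mem (hRT : IsLRTwisting R T) (N : Multiplier k (B ⊗[k] B)) :
    hashB R T N ∈ Multiplier k (LRTensor R T ⊗[k] LRTensor R T) := by
  intro x y
  obtain ⟨x, rfl⟩ := (legsT R T).surjective x
  obtain ⟨y, rfl⟩ := (legsR R T).surjective y
  induction x with
  | zero => simp
  | add x y hx hy => simp only [map_add, add_mul, hx, hy]
  | tmul t s =>
  induction y with
  | zero => simp
  | add x y hx hy => simp only [map_add, mul_add, hx, hy]
  | tmul s' t' =>
  rw [hashB_right_legsT, hashB_left_legsR]
  induction t with
  | zero => simp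
  | add x y hx hy => simp only [TensorProduct.add_tmul, map_add, add_mul, hx, hy]
  | tmul b c =>
  induction t' with
  | zero => simp
  | add x y hx hy => simp only [TensorProduct.tmul_add, map_add, mul_add, hx, hy]
  | tmul b' c' => rw [legsT_mul_legsR hRT, legsT_mul_legsR hRT, N.2 s s']

/-- `M ↦ M # (1 ⊗ 1)` as a linear map between multiplier algebras. -/
def hashALin (hRT : IsLRTwisting R T) :
    Multiplier k (A ⊗[k] A) →ₗ[k] Multiplier k (LRTensor R T ⊗[k] LRTensor R T) where
  toFun M := ⟨hashA R T M, hashA_mem hRT M⟩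
  map_add' M N := Subtype.ext (endPair_ext_legs (legsT R T) (legsR R T)
    (fun s t => by simp [hashA_left_legsT, TensorProduct.add_tmul])
    (fun s t => by simp [hashA_right_legsR, TensorProduct.tmul_add]))
  map_smul' c M := Subtype.ext (endPair_ext_legs (legsT R T) (legsR R T)
    (fun s t => by simp [hashA_left_legsT, ← TensorProduct.smul_tmul'])
    (fun s t => by simp [hashA_right_legsR]))

/-- `N ↦ (1 ⊗ 1) # N` as a linear map between multiplier algebras. -/
def hashBLin (hRT : IsLRTwisting R T) :
    Multiplier k (B ⊗[k] B) →ₗ[k] Multiplier k (LRTensor R T ⊗[k] LRTensor R T) where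
  toFun N := ⟨hashB R T N, hashB_mem hRT N⟩
  map_add' M N := Subtype.ext (endPair_ext_legs (legsR R T) (legsT R T)
    (fun s t => by simp [hashB_left_legsR, TensorProduct.add_tmul])
    (fun s t => by simp [hashB_right_legsT, TensorProduct.tmul_add]))
  map_smul' c M := Subtype.ext (endPair_ext_legs (legsR R T) (legsT R T)
    (fun s t => by simp [hashB_left_legsR, ← TensorProduct.smul_tmul'])
    (fun s t => by simp [hashB_right_legsT]))

theorem hashALin_mul (hRT : IsLRTwisting R T) (M N : Multiplier k (A ⊗[k] A)) :
    hashALin hRT (M * N) = hashALin hRT M * hashALin hRT N :=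
  Subtype.ext (endPair_ext_legs (legsT R T) (legsR R T)
    (fun s t => by simp [hashALin, hashA_left_legsT])
    (fun s t => by simp [hashALin, hashA_right_legsR]))

theorem hashBLin_mul (hRT : IsLRTwisting R T) (M N : Multiplier k (B ⊗[k] B)) :
    hashBLin hRT (M * N) = hashBLin hRT M * hashBLin hRT N :=
  Subtype.ext (endPair_ext_legs (legsR R T) (legsT R T)
    (fun s t => by simp [hashBLin, hashB_left_legsR])
    (fun s t => by simp [hashBLin, hashB_right_legsT]))

/-- The action `f ⊗ g` of `V ⊗ V` on `D ⊗ D`, for two actions `f` and `g` of `V` on `D`. -/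
def actTensor {V D : Type*} [AddCommGroup V] [Module k V] [AddCommGroup D] [Module k D]
    (f : V →ₗ[k] D →ₗ[k] D) : V ⊗[k] V →ₗ[k] D ⊗[k] D →ₗ[k] D ⊗[k] D :=
  TensorProduct.homTensorHomMap (.id k) D D D D ∘ₗ TensorProduct.map f f

theorem actTensor_tmul {V D : Type*} [AddCommGroup V] [Module k V] [AddCommGroup D] [Module k D]
    (f : V →ₗ[k] D →ₗ[k] D) (v v' : V) (s t : D) :
    actTensor f (v ⊗ₜ v') (s ⊗ₜ t) = f v s ⊗ₜ f v' t := rfl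

/-- `(M # (1 ⊗ 1)) (1 ⊗ (a # 1))` is the action of `M (1 ⊗ a) ∈ A ⊗ A`. -/
theorem hashA_lamA (hRT : IsLRTwisting R T) (M : Multiplier k (A ⊗[k] A)) (a : A)
    (Z : A ⊗[k] A) (h : EqMulOneTmul (M : EndPair k (A ⊗[k] A)) a Z) (s t : LRTensor R T) :
    (hashA R T M).1 (s ⊗ₜ lamA R T a t) = actTensor (lamA R T) Z (s ⊗ₜ t) := by
  obtain ⟨s, rfl⟩ := (mulAB R T).surjective s
  obtain ⟨t, rfl⟩ := (mulAB R T).surjective t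
  induction s with
  | zero => simp
  | add x y hx hy => simp only [map_add, TensorProduct.add_tmul, hx, hy]
  | tmul a₁ b₁ =>
  induction t with
  | zero => simp
  | add x y hx hy => simp only [map_add, TensorProduct.tmul_add, hx, hy]
  | tmul a₂ b₂ =>
    have h1 := h.1 (a₁ ⊗ₜ a₂)
    rw [LinearMap.lTensor_tmul, LinearMap.mulLeft_apply] at h1
    rw [lamA_mulAB hRT, ← legsT_tmul, hashA_left_legsT, h1]
    clear h h1
    induction Z with
    | zero => simp
    | add x y hx hy =>
      simp only [map_add, add_mul, TensorProduct.add_tmul, LinearMap.add_apply, hx, hy]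
    | tmul p q => simp [legsT_tmul, actTensor_tmul, lamA_mulAB hRT]

/-- `((1 ⊗ 1) # N) (1 ⊗ (1 # b))` is the action of `N (1 ⊗ b) ∈ B ⊗ B`. -/
theorem hashB_lamB (hRT : IsLRTwisting R T) (N : Multiplier k (B ⊗[k] B)) (b : B)
    (Z : B ⊗[k] B) (h : EqMulOneTmul (N : EndPair k (B ⊗[k] B)) b Z) (s t : LRTensor R T) :
    (hashB R T N).1 (s ⊗ₜ lamB R T b t) = actTensor (lamB R T) Z (s ⊗ₜ t) := by
  obtain ⟨s, rfl⟩ := (mulBA R T).surjective s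
  obtain ⟨t, rfl⟩ := (mulBA R T).surjective t
  induction s with
  | zero => simp
  | add x y hx hy => simp only [map_add, TensorProduct.add_tmul, hx, hy]
  | tmul b₁ a₁ =>
  induction t with
  | zero => simp
  | add x y hx hy => simp only [map_add, TensorProduct.tmul_add, hx, hy]
  | tmul b₂ a₂ =>
    have h1 := h.1 (b₁ ⊗ₜ b₂)
    rw [LinearMap.lTensor_tmul, LinearMap.mulLeft_apply] at h1
    rw [lamB_mulBA hRT, ← legsR_tmul, hashB_left_legsR, h1]
    clear h h1
    induction Z with
    | zero => simp
    | add x y hx hy =>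
      simp only [map_add, add_mul, TensorProduct.add_tmul, LinearMap.add_apply, hx, hy]
    | tmul p q => simp [legsR_tmul, actTensor_tmul, lamB_mulBA hRT]

/-- `((a # 1) ⊗ 1) (M # (1 ⊗ 1))` is the action of `(a ⊗ 1) M ∈ A ⊗ A`. -/
theorem hashA_rhoA (hRT : IsLRTwisting R T) (M : Multiplier k (A ⊗[k] A)) (a : A)
    (Z : A ⊗[k] A) (h : EqTmulOneMul a (M : EndPair k (A ⊗[k] A)) Z) (s t : LRTensor R T) :
    (hashA R T M).2.unop (rhoA R T a s ⊗ₜ t) = actTensor (rhoA R T) Z (s ⊗ₜ t) := by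
  obtain ⟨s, rfl⟩ := (mulBA R T).surjective s
  obtain ⟨t, rfl⟩ := (mulBA R T).surjective t
  induction s with
  | zero => simp
  | add x y hx hy => simp only [map_add, TensorProduct.add_tmul, hx, hy]
  | tmul b₁ a₁ =>
  induction t with
  | zero => simp
  | add x y hx hy => simp only [map_add, TensorProduct.tmul_add, hx, hy]
  | tmul b₂ a₂ =>
    have h1 := h.2 (a₁ ⊗ₜ a₂)
    rw [LinearMap.rTensor_tmul, LinearMap.mulRight_apply] at h1
    rw [rhoA_mulBA hRT, ← legsR_tmul, hashA_right_legsR, h1]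
    clear h h1
    induction Z with
    | zero => simp
    | add x y hx hy =>
      simp only [map_add, mul_add, TensorProduct.tmul_add, LinearMap.add_apply, hx, hy]
    | tmul p q => simp [legsR_tmul, actTensor_tmul, rhoA_mulBA hRT]

/-- `((1 # b) ⊗ 1) ((1 ⊗ 1) # N)` is the action of `(b ⊗ 1) N ∈ B ⊗ B`. -/
theorem hashB_rhoB (hRT : IsLRTwisting R T) (N : Multiplier k (B ⊗[k] B)) (b : B)
    (Z : B ⊗[k] B) (h : EqTmulOneMul b (N : EndPair k (B ⊗[k] B)) Z) (s t : LRTensor R T) :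
    (hashB R T N).2.unop (rhoB R T b s ⊗ₜ t) = actTensor (rhoB R T) Z (s ⊗ₜ t) := by
  obtain ⟨s, rfl⟩ := (mulAB R T).surjective s
  obtain ⟨t, rfl⟩ := (mulAB R T).surjective t
  induction s with
  | zero => simp
  | add x y hx hy => simp only [map_add, TensorProduct.add_tmul, hx, hy]
  | tmul a₁ b₁ =>
  induction t with
  | zero => simp
  | add x y hx hy => simp only [map_add, TensorProduct.tmul_add, hx, hy]
  | tmul a₂ b₂ =>
    have h1 := h.2 (b₁ ⊗ₜ b₂)
    rw [LinearMap.rTensor_tmul, LinearMap.mulRight_apply] at h1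
    rw [rhoB_mulAB hRT, ← legsT_tmul, hashB_right_legsT, h1]
    clear h h1
    induction Z with
    | zero => simp
    | add x y hx hy =>
      simp only [map_add, mul_add, TensorProduct.tmul_add, LinearMap.add_apply, hx, hy]
    | tmul p q => simp [legsT_tmul, actTensor_tmul, rhoB_mulAB hRT]

/-- The linear map `Δ` with `Δ((1 # b)(a # 1)) = ((1 ⊗ 1) # Δ_B(b)) (Δ_A(a) # (1 ⊗ 1))`. -/
def lrComul (hRT : IsLRTwisting R T) (HA : MultiplierHopfAlgebra k A)
    (HB : MultiplierHopfAlgebra k B) :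
    LRTensor R T →ₗ[k] Multiplier k (LRTensor R T ⊗[k] LRTensor R T) :=
  LinearMap.mul' k _ ∘ₗ
    TensorProduct.map (hashBLin hRT ∘ₗ HB.comul) (hashALin hRT ∘ₗ HA.comul) ∘ₗ
    (mulBA R T).symm.toLinearMap

theorem lrComul_mulBA (hRT : IsLRTwisting R T) (HA : MultiplierHopfAlgebra k A)
    (HB : MultiplierHopfAlgebra k B) (b : B) (a : A) :
    lrComul hRT HA HB (mulBA R T (b ⊗ₜ a)) =
      hashBLin hRT (HB.comul b) * hashALin hRT (HA.comul a) := by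
  simp [lrComul]

theorem lrComul_rhoA_lamB (hRT : IsLRTwisting R T) (HA : MultiplierHopfAlgebra k A)
    (HB : MultiplierHopfAlgebra k B) (b : B) (a : A) (u : LRTensor R T) :
    lrComul hRT HA HB (rhoA R T a (lamB R T b u)) =
      hashBLin hRT (HB.comul b) * lrComul hRT HA HB u * hashALin hRT (HA.comul a) := by
  obtain ⟨u, rfl⟩ := (mulBA R T).surjective u
  induction u with
  | zero => simp
  | add x y hx hy => simp only [map_add, mul_add, add_mul, hx, hy]
  | tmul d c =>
    rw [lamB_mulBA hRT, rhoA_mulBA hRT, lrComul_mulBA, lrComul_mulBA, HB.comul_mul, HA.comul_mul,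
      hashALin_mul, hashBLin_mul]
    simp only [mul_assoc]

/-- `Δ` is multiplicative as soon as `Δ((a # 1)(1 # b)) = (Δ_A(a) # (1 ⊗ 1)) ((1 ⊗ 1) # Δ_B(b))`:
the product `(1 # b)(a # 1) (1 # d)(c # 1)` has the factor `(a # 1)(1 # d)` in the middle. -/
theorem lrComul_mul (hRT : IsLRTwisting R T) (HA : MultiplierHopfAlgebra k A)
    (HB : MultiplierHopfAlgebra k B)
    (hT : ∀ (a : A) (b : B), lrComul hRT HA HB (mulAB R T (a ⊗ₜ b)) =
      hashALin hRT (HA.comul a) * hashBLin hRT (HB.comul b)) (u v : LRTensor R T) :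
    lrComul hRT HA HB (u * v) = lrComul hRT HA HB u * lrComul hRT HA HB v := by
  obtain ⟨u, rfl⟩ := (mulBA R T).surjective u
  obtain ⟨v, rfl⟩ := (mulBA R T).surjective v
  induction u with
  | zero => simp
  | add x y hx hy => simp only [map_add, add_mul, hx, hy]
  | tmul b a =>
  induction v with
  | zero => simp
  | add x y hx hy => simp only [map_add, mul_add, hx, hy]
  | tmul d c =>
    rw [mulBA_mul hRT, ← rhoA_mulAB hRT, lamB_rhoA hRT, lrComul_rhoA_lamB, hT, lrComul_mulBA,
      lrComul_mulBA]
    simp only [mul_assoc]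

/-! ### The maps `T₁` and `T₂` -/

variable (R T) in
/-- `T₁`: as `Δ(b a)(1 ⊗ v) = b₁ a₁ ⊗ b₂ a₂ v` for `b a = (1 # b)(a # 1)`, it is composed of the
maps `a ⊗ v ↦ a₁ ⊗ a₂ v` and `b ⊗ v ↦ b₁ ⊗ b₂ v`. -/
def lrT₁ (HA : MultiplierHopfAlgebra k A) (HB : MultiplierHopfAlgebra k B) :
    (LRTensor R T ⊗[k] LRTensor R T) ≃ₗ[k] (LRTensor R T ⊗[k] LRTensor R T) :=
  composeRight (mulBA R T) (extendRight HA.T₁ (mulAB R T)) (extendRight HB.T₁ (mulBA R T))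

variable (R T) in
/-- `T₂`: as `(v ⊗ 1)Δ(b a) = v b₁ a₁ ⊗ b₂ a₂` for `b a = (1 # b)(a # 1)`, it is composed of the
maps `v ⊗ b ↦ v b₁ ⊗ b₂` and `v ⊗ a ↦ v a₁ ⊗ a₂`. -/
def lrT₂ (HA : MultiplierHopfAlgebra k A) (HB : MultiplierHopfAlgebra k B) :
    (LRTensor R T ⊗[k] LRTensor R T) ≃ₗ[k] (LRTensor R T ⊗[k] LRTensor R T) :=
  composeLeft (mulBA R T) (extendLeft HA.T₂ (mulBA R T)) (extendLeft HB.T₂ (mulAB R T))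

theorem legCommute_lrT (HA : MultiplierHopfAlgebra k A) (HB : MultiplierHopfAlgebra k B) :
    LegCommute (lrT₂ R T HA HB) (lrT₁ R T HA HB) := by
  have hA : LegCommute HA.T₂ HA.T₁ := legCommute_iff.2 HA.coassoc
  have hB : LegCommute HB.T₂ HB.T₁ := legCommute_iff.2 HB.coassoc
  exact (hA.extend _ _).compose (hB.extend _ _) _

/-- The part of `T₁` that involves `Δ_B`: `(b₁ a ⊗ b₂ v)(s ⊗ t)`. -/
theorem hashB_lamA_lrT₁ (hRT : IsLRTwisting R T) (HB : MultiplierHopfAlgebra k B) (b : B) (a : A)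
    (s t v : LRTensor R T) :
    (hashB R T (HB.comul b)).1 (lamA R T a s ⊗ₜ (v * t)) =
      (mulBA R T).rTensor (LRTensor R T)
        (firstLast A (extendRight HB.T₁ (mulBA R T)) ((b ⊗ₜ a) ⊗ₜ v)) * (s ⊗ₜ t) := by
  obtain ⟨v, rfl⟩ := (mulBA R T).surjective v
  induction v with
  | zero => simp
  | add x y hx hy => simp only [map_add, add_mul, TensorProduct.tmul_add, hx, hy]
  | tmul d c =>
    rw [mulBA_mul hRT, hashB_lamB hRT _ _ _ (HB.T₁_spec b d), firstLast_tmul, extendRight_tmul]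
    induction HB.T₁ (b ⊗ₜ d) with
    | zero => simp
    | add x y hx hy =>
      simp only [map_add, add_mul, TensorProduct.tmul_add, LinearMap.add_apply, hx, hy]
    | tmul p q =>
      change lamB R T p (lamA R T a s) ⊗ₜ lamB R T q (lamA R T c t) =
        (mulBA R T (p ⊗ₜ a) ⊗ₜ mulBA R T (q ⊗ₜ c)) * (s ⊗ₜ t)
      rw [Algebra.TensorProduct.tmul_mul_tmul, mulBA_mul hRT, mulBA_mul hRT]

theorem lrComul_apply_tmul_mul (hRT : IsLRTwisting R T) (HA : MultiplierHopfAlgebra k A)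
    (HB : MultiplierHopfAlgebra k B) (u s v t : LRTensor R T) :
    (lrComul hRT HA HB u).1.1 (s ⊗ₜ (v * t)) = lrT₁ R T HA HB (u ⊗ₜ v) * (s ⊗ₜ t) := by
  obtain ⟨u, rfl⟩ := (mulBA R T).surjective u
  induction u with
  | zero => simp
  | add x y hx hy =>
    simp only [map_add, add_mul, TensorProduct.add_tmul, Subalgebra.coe_add, Prod.fst_add,
      LinearMap.add_apply, hx, hy]
  | tmul b a =>
  obtain ⟨v, rfl⟩ := (mulAB R T).surjective v
  induction v with
  | zero => simp
  | add x y hx hy => simp only [map_add, add_mul, TensorProduct.tmul_add, hx, hy]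
  | tmul c d =>
    rw [lrT₁, composeRight_tmul, lastTwo_tmul, extendRight_tmul, lrComul_mulBA, mulAB_mul hRT]
    change (hashB R T (HB.comul b)).1 ((hashA R T (HA.comul a)).1
      (s ⊗ₜ lamA R T c (lamB R T d t))) = _
    rw [hashA_lamA hRT _ _ _ (HA.T₁_spec a c)]
    induction HA.T₁ (a ⊗ₜ c) with
    | zero => simp
    | add x y hx hy =>
      simp only [map_add, add_mul, TensorProduct.tmul_add, LinearMap.add_apply, hx, hy]
    | tmul p q =>
      rw [actTensor_tmul, ← mulAB_mul hRT, hashB_lamA_lrT₁ hRT]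
      rfl

/-- The part of `T₂` that involves `Δ_A`: `(s ⊗ t)(v a₁ ⊗ b a₂)`. -/
theorem hashA_rhoB_lrT₂ (hRT : IsLRTwisting R T) (HA : MultiplierHopfAlgebra k A) (b : B) (a : A)
    (s t v : LRTensor R T) :
    (hashA R T (HA.comul a)).2.unop ((s * v) ⊗ₜ rhoB R T b t) =
      (s ⊗ₜ t) * (mulBA R T).lTensor (LRTensor R T)
        (firstThird B (extendLeft HA.T₂ (mulBA R T)) (v ⊗ₜ (b ⊗ₜ a))) := by
  obtain ⟨v, rfl⟩ := (mulBA R T).surjective v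
  induction v with
  | zero => simp
  | add x y hx hy => simp only [map_add, mul_add, TensorProduct.add_tmul, hx, hy]
  | tmul d c =>
    rw [mul_mulBA hRT, hashA_rhoA hRT _ _ _ (HA.T₂_spec c a), firstThird_tmul, extendLeft_tmul]
    induction HA.T₂ (c ⊗ₜ a) with
    | zero => simp
    | add x y hx hy =>
      simp only [map_add, mul_add, TensorProduct.add_tmul, LinearMap.add_apply, hx, hy]
    | tmul p q =>
      change rhoA R T p (rhoB R T d s) ⊗ₜ rhoA R T q (rhoB R T b t) =
        (s ⊗ₜ t) * (mulBA R T (d ⊗ₜ p) ⊗ₜ mulBA R T (b ⊗ₜ q))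
      rw [Algebra.TensorProduct.tmul_mul_tmul, mul_mulBA hRT, mul_mulBA hRT]

theorem lrComul_unop_mul_tmul (hRT : IsLRTwisting R T) (HA : MultiplierHopfAlgebra k A)
    (HB : MultiplierHopfAlgebra k B) (u s v t : LRTensor R T) :
    (lrComul hRT HA HB u).1.2.unop ((s * v) ⊗ₜ t) = (s ⊗ₜ t) * lrT₂ R T HA HB (v ⊗ₜ u) := by
  obtain ⟨u, rfl⟩ := (mulBA R T).surjective u
  induction u with
  | zero => simp
  | add x y hx hy =>
    simp only [map_add, mul_add, TensorProduct.tmul_add, Subalgebra.coe_add, Prod.snd_add,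
      MulOpposite.unop_add, LinearMap.add_apply, hx, hy]
  | tmul b a =>
  obtain ⟨v, rfl⟩ := (mulAB R T).surjective v
  induction v with
  | zero => simp
  | add x y hx hy => simp only [map_add, mul_add, TensorProduct.add_tmul, hx, hy]
  | tmul c d =>
    rw [lrT₂, composeLeft_tmul, firstTwo_tmul, extendLeft_tmul, lrComul_mulBA, mul_mulAB hRT]
    change (hashA R T (HA.comul a)).2.unop ((hashB R T (HB.comul b)).2.unop
      (rhoB R T d (rhoA R T c s) ⊗ₜ t)) = _
    rw [hashB_rhoB hRT _ _ _ (HB.T₂_spec d b)]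
    induction HB.T₂ (d ⊗ₜ b) with
    | zero => simp
    | add x y hx hy =>
      simp only [map_add, mul_add, TensorProduct.add_tmul, LinearMap.add_apply, hx, hy]
    | tmul p q =>
      rw [actTensor_tmul, ← mul_mulAB hRT, hashA_rhoB_lrT₂ hRT]
      rfl

/-- The multiplier Hopf algebra `A #_{RT} B`, for nondegenerate `A #_{RT} B` and a comultiplication
that is compatible with `T`. -/
def lrMultiplierHopfAlgebra (hRT : IsLRTwisting R T) (HA : MultiplierHopfAlgebra k A)
    (HB : MultiplierHopfAlgebra k B)
    (hl : ∀ u : LRTensor R T, (∀ v, u * v = 0) → u = 0)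
    (hr : ∀ u : LRTensor R T, (∀ v, v * u = 0) → u = 0)
    (hT : ∀ (a : A) (b : B), lrComul hRT HA HB (mulAB R T (a ⊗ₜ b)) =
      hashALin hRT (HA.comul a) * hashBLin hRT (HB.comul b)) :
    MultiplierHopfAlgebra k (LRTensor R T) where
  assoc := lrMul_assoc hRT
  nondeg_left := hl
  nondeg_right := hr
  comul := lrComul hRT HA HB
  comul_mul := lrComul_mul hRT HA HB hT
  T₁ := lrT₁ R T HA HB
  T₁_spec u v := eqMulOneTmul_of_left (lrMul_assoc hRT) hl _ _ _ fun s t =>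
    lrComul_apply_tmul_mul hRT HA HB u s v t
  T₂ := lrT₂ R T HA HB
  T₂_spec v u := eqTmulOneMul_of_right (lrMul_assoc hRT) hr _ _ _ fun s t =>
    lrComul_unop_mul_tmul hRT HA HB u s v t
  coassoc := legCommute_iff.1 (legCommute_lrT HA HB)

end Comul

/-! ### Slices of the maps `T₁` and `T₂` by the counit -/

section Slices

variable {k D : Type*} [Field k] [NonUnitalNonAssocRing D] [Module k D]

theorem lid_rTensor_lTensor_mulRight [IsScalarTower k D D] (ε : D →ₗ[k] k) (w : D) (z : D ⊗[k] D) :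
    TensorProduct.lid k D (ε.rTensor D ((LinearMap.mulRight k w).lTensor D z)) =
      TensorProduct.lid k D (ε.rTensor D z) * w := by
  induction z with
  | zero => simp
  | add x y hx hy => simp only [map_add, add_mul, hx, hy]
  | tmul x y => simp [smul_mul_assoc]

theorem rid_lTensor_rTensor_mulLeft [SMulCommClass k D D] (ε : D →ₗ[k] k) (w : D) (z : D ⊗[k] D) :
    TensorProduct.rid k D (ε.lTensor D ((LinearMap.mulLeft k w).rTensor D z)) =
      w * TensorProduct.rid k D (ε.lTensor D z) := by
  induction z with
  | zero => simp
  | add x y hx hy => simp only [map_add, mul_add, hx, hy]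
  | tmul x y => simp [mul_smul_comm]

variable [IsScalarTower k D D] [SMulCommClass k D D]

/-- `((c ⊗ 1)Δ(a))(1 ⊗ b) = (c ⊗ 1)(Δ(a)(1 ⊗ b))`. -/
theorem MultiplierHopfAlgebra.lTensor_T₂ (H : MultiplierHopfAlgebra k D) (a b c : D) :
    (LinearMap.mulRight k b).lTensor D (H.T₂ (c ⊗ₜ a)) =
      (LinearMap.mulLeft k c).rTensor D (H.T₁ (a ⊗ₜ b)) := by
  refine tensor_eq_of_mul_right H.nondeg_left fun s t => ?_
  rw [lTensor_mulRight_mul H.assoc, ← (H.T₂_spec c a).1, (H.T₁_spec a b).1]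
  induction H.T₁ (a ⊗ₜ b) with
  | zero => simp
  | add x y hx hy => simp only [map_add, add_mul, hx, hy]
  | tmul x y => simp [H.assoc]

/-- `(ε ⊗ id)((c ⊗ 1)Δ(a)) = ε(c) a`. -/
theorem IsCounit.lid_T₂ {H : MultiplierHopfAlgebra k D} {ε : D →ₗ[k] k} (hε : IsCounit H ε)
    (c a : D) : TensorProduct.lid k D (ε.rTensor D (H.T₂ (c ⊗ₜ a))) = ε c • a := by
  rw [← sub_eq_zero]
  refine H.nondeg_left _ fun b => ?_
  rw [sub_mul, ← lid_rTensor_lTensor_mulRight, H.lTensor_T₂, smul_mul_assoc, ← hε.left,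
    sub_eq_zero]
  induction H.T₁ (a ⊗ₜ b) with
  | zero => simp
  | add x y hx hy => simp only [map_add, smul_add, hx, hy]
  | tmul x y => simp [hε.map_mul, mul_smul]

/-- `(id ⊗ ε)(Δ(a)(1 ⊗ c)) = ε(c) a`. -/
theorem IsCounit.rid_T₁ {H : MultiplierHopfAlgebra k D} {ε : D →ₗ[k] k} (hε : IsCounit H ε)
    (c a : D) : TensorProduct.rid k D (ε.lTensor D (H.T₁ (a ⊗ₜ c))) = ε c • a := by
  rw [← sub_eq_zero]
  refine H.nondeg_right _ fun b => ?_
  rw [mul_sub, ← rid_lTensor_rTensor_mulLeft, ← H.lTensor_T₂, mul_smul_comm, ← hε.right,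
    sub_eq_zero]
  induction H.T₂ (b ⊗ₜ a) with
  | zero => simp
  | add x y hx hy => simp only [map_add, smul_add, hx, hy]
  | tmul x y => simp [hε.map_mul, smul_smul, mul_comm]

theorem IsCounit.eq_zero_of_counit_eq_zero {H : MultiplierHopfAlgebra k D} {ε : D →ₗ[k] k}
    (hε : IsCounit H ε) (h : ∀ c, ε c = 0) (a : D) : a = 0 := by
  have h0 : ε = 0 := LinearMap.ext h
  refine H.nondeg_left _ fun b => ?_
  rw [← hε.left, h0]
  simp

end Slices

/-! ### The formula `Δ_{RT}(a # x) = (a₁ # x₁) ⊗ (a₂ # x₂)` -/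

section Twisted

variable {k : Type*} {A : Type*} {B : Type*} [Field k]
  [NonUnitalRing A] [Module k A] [IsScalarTower k A A] [SMulCommClass k A A]
  [NonUnitalRing B] [Module k B] [IsScalarTower k B B] [SMulCommClass k B B]
  {R : (B ⊗[k] A) ≃ₗ[k] (A ⊗[k] B)} {T : (A ⊗[k] B) ≃ₗ[k] (A ⊗[k] B)}
  {HA : MultiplierHopfAlgebra k A} {HB : MultiplierHopfAlgebra k B}

theorem IsComulMulOneTmul.unique {u w : LRTensor R T} {Z Z' : LRTensor R T ⊗[k] LRTensor R T}
    (h : IsComulMulOneTmul R T HA HB u w Z) (h' : IsComulMulOneTmul R T HA HB u w Z') :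
    Z = Z' := by
  rw [← sub_eq_zero]
  refine eq_zero_of_rTensor_eq_zero (fun c : A × B => tensorMulLeft R T c.1 c.2) ?_ _ ?_
  · intro v hv
    refine eq_zero_of_map_eq_zero (fun c : A => LinearMap.mulLeft k c)
      (fun z : B => LinearMap.mulLeft k z) (fun v hv => HA.nondeg_right v hv)
      (fun v hv => HB.nondeg_right v hv) _ fun c z => hv (c, z)
  · rintro ⟨c, z⟩
    rw [map_sub, h c z, h' c z, sub_self]

theorem IsTmulOneMulComul.unique {u w : LRTensor R T} {Z Z' : LRTensor R T ⊗[k] LRTensor R T}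
    (h : IsTmulOneMulComul R T HA HB w u Z) (h' : IsTmulOneMulComul R T HA HB w u Z') :
    Z = Z' := by
  rw [← sub_eq_zero]
  refine eq_zero_of_lTensor_eq_zero (fun c : A × B => tensorMulRight R T c.1 c.2) ?_ _ ?_
  · intro v hv
    refine eq_zero_of_map_eq_zero (fun c : A => LinearMap.mulRight k c)
      (fun z : B => LinearMap.mulRight k z) (fun v hv => HA.nondeg_left v hv)
      (fun v hv => HB.nondeg_left v hv) _ fun c z => hv (c, z)
  · rintro ⟨c, z⟩
    rw [map_sub, h c z, h' c z, sub_self]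

theorem IsComul.unique (hl : ∀ u : LRTensor R T, (∀ v, u * v = 0) → u = 0)
    (hr : ∀ u : LRTensor R T, (∀ v, v * u = 0) → u = 0) {u : LRTensor R T}
    {X Y : EndPair k (LRTensor R T ⊗[k] LRTensor R T)}
    (hX : IsComul R T HA HB u X) (hY : IsComul R T HA HB u Y) : X = Y := by
  refine EndPair.ext_of_mul hl hr (fun w => ?_) fun w => ?_
  · obtain ⟨Z, h1, h2⟩ := hX.1 w
    obtain ⟨Z', h1', h2'⟩ := hY.1 w
    exact ⟨Z, h1, h2.unique h2' ▸ h1'⟩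
  · obtain ⟨Z, h1, h2⟩ := hX.2 w
    obtain ⟨Z', h1', h2'⟩ := hY.2 w
    exact ⟨Z, h1, h2.unique h2' ▸ h1'⟩

theorem IsComul.zero : IsComul R T HA HB 0 0 :=
  ⟨fun w => ⟨0, ⟨fun s => by simp, fun s => by simp⟩, fun c z => by simp⟩,
    fun w => ⟨0, ⟨fun s => by simp, fun s => by simp⟩, fun c z => by simp⟩⟩

theorem IsComul.add {u v : LRTensor R T} {X Y : EndPair k (LRTensor R T ⊗[k] LRTensor R T)}
    (hX : IsComul R T HA HB u X) (hY : IsComul R T HA HB v Y) :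
    IsComul R T HA HB (u + v) (X + Y) := by
  refine ⟨fun w => ?_, fun w => ?_⟩
  · obtain ⟨Z, h1, h2⟩ := hX.1 w
    obtain ⟨Z', h1', h2'⟩ := hY.1 w
    refine ⟨Z + Z', ⟨fun s => ?_, fun s => ?_⟩, fun c z => ?_⟩
    · rw [Prod.fst_add, LinearMap.add_apply, h1.1, h1'.1, add_mul]
    · rw [Prod.snd_add, MulOpposite.unop_add, LinearMap.add_apply, map_add, h1.2, h1'.2, mul_add]
    · rw [map_add, map_add, map_add, h2 c z, h2' c z]
  · obtain ⟨Z, h1, h2⟩ := hX.2 w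
    obtain ⟨Z', h1', h2'⟩ := hY.2 w
    refine ⟨Z + Z', ⟨fun s => ?_, fun s => ?_⟩, fun c z => ?_⟩
    · rw [Prod.fst_add, LinearMap.add_apply, map_add, h1.1, h1'.1, add_mul]
    · rw [Prod.snd_add, MulOpposite.unop_add, LinearMap.add_apply, h1.2, h1'.2, mul_add]
    · rw [map_add, map_add, map_add, h2 c z, h2' c z]

/-- The formula for `Δ_{RT}` is linear, so it holds everywhere if it holds on the image of `R`. -/
theorem isComul_lrComul (hRT : IsLRTwisting R T)
    (hR : ∀ (x : B) (a : A), IsComul R T HA HB (hash R T (R (x ⊗ₜ a)))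
      (hashB R T (HB.comul x) * hashA R T (HA.comul a))) (u : LRTensor R T) :
    IsComul R T HA HB u (lrComul hRT HA HB u) := by
  obtain ⟨u, rfl⟩ := (mulBA R T).surjective u
  induction u with
  | zero => simpa using IsComul.zero
  | add x y hx hy => simpa using hx.add hy
  | tmul b a =>
    rw [lrComul_mulBA]
    exact hR b a

/-! ### The counit -/

theorem lid_comulCoveredLeft {εA : A →ₗ[k] k} {εB : B →ₗ[k] k} (hεA : IsCounit HA εA)
    (hεB : IsCounit HB εB) (c : A) (z : B) (u : LRTensor R T) :
    TensorProduct.lid k (LRTensor R T) ((lrCounit R T εA εB).rTensor (LRTensor R T)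
      (comulCoveredLeft R T HA HB c z u)) = (εA c * εB z) • u := by
  obtain ⟨u, rfl⟩ := (hash R T).surjective u
  induction u with
  | zero => simp
  | add x y hx hy => simp only [map_add, smul_add, hx, hy]
  | tmul a x =>
    have key : ∀ (s : A ⊗[k] A) (t : B ⊗[k] B), TensorProduct.lid k (LRTensor R T)
        ((lrCounit R T εA εB).rTensor (LRTensor R T) (hash₂ R T
          (TensorProduct.tensorTensorTensorComm k A A B B (s ⊗ₜ t)))) =
        hash R T (TensorProduct.lid k A (εA.rTensor A s) ⊗ₜ
          TensorProduct.lid k B (εB.rTensor B t)) := by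
      intro s t
      induction s with
      | zero => simp
      | add x y hx hy => simp only [map_add, TensorProduct.add_tmul, hx, hy]
      | tmul p q =>
      induction t with
      | zero => simp
      | add x y hx hy => simp only [map_add, TensorProduct.tmul_add, hx, hy]
      | tmul p' q' =>
        change (εA p * εB p') • hash R T (q ⊗ₜ q') = hash R T ((εA p • q) ⊗ₜ (εB p' • q'))
        rw [TensorProduct.smul_tmul_smul, map_smul]
    refine (key (HA.T₂ (c ⊗ₜ a)) (HB.T₂ (z ⊗ₜ x))).trans ?_
    rw [hεA.lid_T₂, hεB.lid_T₂, TensorProduct.smul_tmul_smul, map_smul]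

theorem rid_comulCoveredRight {εA : A →ₗ[k] k} {εB : B →ₗ[k] k} (hεA : IsCounit HA εA)
    (hεB : IsCounit HB εB) (c : A) (z : B) (u : LRTensor R T) :
    TensorProduct.rid k (LRTensor R T) ((lrCounit R T εA εB).lTensor (LRTensor R T)
      (comulCoveredRight R T HA HB c z u)) = (εA c * εB z) • u := by
  obtain ⟨u, rfl⟩ := (hash R T).surjective u
  induction u with
  | zero => simp
  | add x y hx hy => simp only [map_add, smul_add, hx, hy]
  | tmul a x =>
    have key : ∀ (s : A ⊗[k] A) (t : B ⊗[k] B), TensorProduct.rid k (LRTensor R T)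
        ((lrCounit R T εA εB).lTensor (LRTensor R T) (hash₂ R T
          (TensorProduct.tensorTensorTensorComm k A A B B (s ⊗ₜ t)))) =
        hash R T (TensorProduct.rid k A (εA.lTensor A s) ⊗ₜ
          TensorProduct.rid k B (εB.lTensor B t)) := by
      intro s t
      induction s with
      | zero => simp
      | add x y hx hy => simp only [map_add, TensorProduct.add_tmul, hx, hy]
      | tmul p q =>
      induction t with
      | zero => simp
      | add x y hx hy => simp only [map_add, TensorProduct.tmul_add, hx, hy]
      | tmul p' q' =>
        change (εA q * εB q') • hash R T (p ⊗ₜ p') = hash R T ((εA q • p) ⊗ₜ (εB q' • p'))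
        rw [TensorProduct.smul_tmul_smul, map_smul]
    refine (key (HA.T₁ (a ⊗ₜ c)) (HB.T₁ (x ⊗ₜ z))).trans ?_
    rw [hεA.rid_T₁, hεB.rid_T₁, TensorProduct.smul_tmul_smul, map_smul]

theorem lrCounit_tensorMulLeft {εA : A →ₗ[k] k} {εB : B →ₗ[k] k} (hεA : IsCounit HA εA)
    (hεB : IsCounit HB εB) (c : A) (z : B) (u : LRTensor R T) :
    lrCounit R T εA εB (tensorMulLeft R T c z u) = (εA c * εB z) * lrCounit R T εA εB u := by
  obtain ⟨u, rfl⟩ := (hash R T).surjective u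
  induction u with
  | zero => simp
  | add x y hx hy => simp only [map_add, mul_add, hx, hy]
  | tmul a x =>
    change εA (c * a) * εB (z * x) = (εA c * εB z) * (εA a * εB x)
    rw [hεA.map_mul, hεB.map_mul]
    ring

theorem lrCounit_tensorMulRight {εA : A →ₗ[k] k} {εB : B →ₗ[k] k} (hεA : IsCounit HA εA)
    (hεB : IsCounit HB εB) (c : A) (z : B) (u : LRTensor R T) :
    lrCounit R T εA εB (tensorMulRight R T c z u) = (εA c * εB z) * lrCounit R T εA εB u := by
  obtain ⟨u, rfl⟩ := (hash R T).surjective u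
  induction u with
  | zero => simp
  | add x y hx hy => simp only [map_add, mul_add, hx, hy]
  | tmul a x =>
    change εA (a * c) * εB (x * z) = (εA c * εB z) * (εA a * εB x)
    rw [hεA.map_mul, hεB.map_mul]
    ring

/-- Unless `A` or `B` is zero, covering elements can be chosen outside the kernel of the counit. -/
theorem exists_counit_mul_ne_zero {εA : A →ₗ[k] k} {εB : B →ₗ[k] k} (hεA : IsCounit HA εA)
    (hεB : IsCounit HB εB) {u v : LRTensor R T} (huv : u ≠ v) :
    ∃ (c : A) (z : B), εA c * εB z ≠ 0 := by
  by_contra! h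
  have h0 : ∀ t : A ⊗[k] B, t = 0 := by
    by_cases hA : ∀ c, εA c = 0
    · intro t
      induction t with
      | zero => rfl
      | add x y hx hy => rw [hx, hy, add_zero]
      | tmul a b => rw [hεA.eq_zero_of_counit_eq_zero hA a, TensorProduct.zero_tmul]
    · push Not at hA
      obtain ⟨c, hc⟩ := hA
      intro t
      induction t with
      | zero => rfl
      | add x y hx hy => rw [hx, hy, add_zero]
      | tmul a b =>
        rw [hεB.eq_zero_of_counit_eq_zero
          (fun z => (mul_eq_zero.1 (h c z)).resolve_left hc) b, TensorProduct.tmul_zero]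
  exact huv ((h0 u).trans (h0 v).symm)

/-- `(ε_{RT} ⊗ id)(Δ_{RT}(u)(1 ⊗ w)) = u w`. -/
theorem IsComulMulOneTmul.lid_counit {εA : A →ₗ[k] k} {εB : B →ₗ[k] k} (hεA : IsCounit HA εA)
    (hεB : IsCounit HB εB) {u w : LRTensor R T} {Z : LRTensor R T ⊗[k] LRTensor R T}
    (h : IsComulMulOneTmul R T HA HB u w Z) :
    TensorProduct.lid k (LRTensor R T) ((lrCounit R T εA εB).rTensor (LRTensor R T) Z) =
      u * w := by
  by_contra hne
  obtain ⟨c, z, hcz⟩ := exists_counit_mul_ne_zero hεA hεB hne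
  have h1 := congrArg (fun y => TensorProduct.lid k (LRTensor R T)
    ((lrCounit R T εA εB).rTensor (LRTensor R T) y)) (h c z)
  simp only [lid_rTensor_lTensor_mulRight, lid_comulCoveredLeft hεA hεB, smul_mul_assoc] at h1
  refine hne (smul_right_injective _ hcz (Eq.trans ?_ h1))
  clear h h1 hne
  induction Z with
  | zero => simp
  | add x y hx hy => simp only [map_add, smul_add] at hx hy ⊢; rw [hx, hy]
  | tmul s t => simp [lrCounit_tensorMulLeft hεA hεB, mul_smul]

/-- `(id ⊗ ε_{RT})((w ⊗ 1)Δ_{RT}(u)) = w u`. -/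
theorem IsTmulOneMulComul.rid_counit {εA : A →ₗ[k] k} {εB : B →ₗ[k] k} (hεA : IsCounit HA εA)
    (hεB : IsCounit HB εB) {u w : LRTensor R T} {Z : LRTensor R T ⊗[k] LRTensor R T}
    (h : IsTmulOneMulComul R T HA HB w u Z) :
    TensorProduct.rid k (LRTensor R T) ((lrCounit R T εA εB).lTensor (LRTensor R T) Z) =
      w * u := by
  by_contra hne
  obtain ⟨c, z, hcz⟩ := exists_counit_mul_ne_zero hεA hεB hne
  have h1 := congrArg (fun y => TensorProduct.rid k (LRTensor R T)
    ((lrCounit R T εA εB).lTensor (LRTensor R T) y)) (h c z)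
  simp only [rid_lTensor_rTensor_mulLeft, rid_comulCoveredRight hεA hεB, mul_smul_comm] at h1
  refine hne (smul_right_injective _ hcz (Eq.trans ?_ h1))
  clear h h1 hne
  induction Z with
  | zero => simp
  | add x y hx hy => simp only [map_add, smul_add] at hx hy ⊢; rw [hx, hy]
  | tmul s t => simp [lrCounit_tensorMulRight hεA hεB, mul_smul]

/-! ### The antipode -/

theorem mulAB_R_comm (SA : A →ₗ[k] A) (SB : B →ₗ[k] B) (v : A ⊗[k] B) :
    mulAB R T (R (TensorProduct.comm k A B (TensorProduct.map SA SB v))) =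
      lrAntipode R T SA SB (hash R T v) := by
  induction v with
  | zero => simp
  | add x y hx hy => simp only [map_add, hx, hy]
  | tmul a b => rfl

/-- `(T * R)(S_A ⊗ S_B ⊗ id)` is `m(S_{RT} ⊗ id)`. -/
theorem hash_TstarR_antipode (hRT : IsLRTwisting R T) (SA : A →ₗ[k] A) (SB : B →ₗ[k] B)
    (Z : LRTensor R T ⊗[k] LRTensor R T) :
    hash R T (TstarR R T ((TensorProduct.map SA SB).rTensor (A ⊗[k] B) ((hash₂ R T).symm Z))) =
      LinearMap.mul' k (LRTensor R T) ((lrAntipode R T SA SB).rTensor (LRTensor R T) Z) := by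
  obtain ⟨Z, rfl⟩ := (hash₂ R T).surjective Z
  rw [LinearEquiv.symm_apply_apply]
  induction Z with
  | zero => simp
  | add x y hx hy => simp only [map_add, hx, hy]
  | tmul v w =>
    rw [LinearMap.rTensor_tmul, hash_TstarR hRT, mulAB_R_comm]
    rfl

/-- `(R * T)(id ⊗ S_A ⊗ S_B)` is `m(id ⊗ S_{RT})`. -/
theorem hash_RstarT_antipode (hRT : IsLRTwisting R T) (SA : A →ₗ[k] A) (SB : B →ₗ[k] B)
    (Z : LRTensor R T ⊗[k] LRTensor R T) :
    hash R T (RstarT R T ((TensorProduct.map SA SB).lTensor (A ⊗[k] B) ((hash₂ R T).symm Z))) =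
      LinearMap.mul' k (LRTensor R T) ((lrAntipode R T SA SB).lTensor (LRTensor R T) Z) := by
  obtain ⟨Z, rfl⟩ := (hash₂ R T).surjective Z
  rw [LinearEquiv.symm_apply_apply]
  induction Z with
  | zero => simp
  | add x y hx hy => simp only [map_add, hx, hy]
  | tmul w v =>
    rw [LinearMap.lTensor_tmul, hash_RstarT hRT, mulAB_R_comm]
    rfl

/-! ### Regularity -/

/-- The pair `τ X`, for a pair `X` of operators on `V ⊗ V`. -/
def flipPair {V : Type*} [AddCommGroup V] [Module k V] (X : EndPair k (V ⊗[k] V)) :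
    EndPair k (V ⊗[k] V) :=
  ((TensorProduct.comm k V V).toLinearMap ∘ₗ X.1 ∘ₗ (TensorProduct.comm k V V).toLinearMap,
    MulOpposite.op ((TensorProduct.comm k V V).toLinearMap ∘ₗ X.2.unop ∘ₗ
      (TensorProduct.comm k V V).toLinearMap))

theorem comm_comm {V : Type*} [AddCommGroup V] [Module k V] (x : V ⊗[k] V) :
    TensorProduct.comm k V V (TensorProduct.comm k V V x) = x :=
  (TensorProduct.comm k V V).symm_apply_apply x

theorem flipPair_mul {V : Type*} [AddCommGroup V] [Module k V] (X Y : EndPair k (V ⊗[k] V)) :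
    flipPair (X * Y) = flipPair X * flipPair Y := by
  refine Prod.ext (LinearMap.ext fun z => ?_)
    (MulOpposite.unop_injective (LinearMap.ext fun z => ?_)) <;>
  simp [flipPair]

theorem flipPair_add {V : Type*} [AddCommGroup V] [Module k V] (X Y : EndPair k (V ⊗[k] V)) :
    flipPair (X + Y) = flipPair X + flipPair Y := by
  refine Prod.ext (LinearMap.ext fun z => ?_)
    (MulOpposite.unop_injective (LinearMap.ext fun z => ?_)) <;>
  simp [flipPair]

theorem flipPair_zero {V : Type*} [AddCommGroup V] [Module k V] :
    flipPair (0 : EndPair k (V ⊗[k] V)) = 0 := by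
  refine Prod.ext (LinearMap.ext fun z => ?_)
    (MulOpposite.unop_injective (LinearMap.ext fun z => ?_)) <;>
  simp [flipPair]

theorem comm_legsT (s : A ⊗[k] A) (t : B ⊗[k] B) :
    TensorProduct.comm k _ _ (legsT R T (s ⊗ₜ t)) =
      legsT R T (TensorProduct.comm k A A s ⊗ₜ TensorProduct.comm k B B t) := by
  induction s with
  | zero => simp
  | add x y hx hy => simp only [map_add, TensorProduct.add_tmul, hx, hy]
  | tmul p q =>
  induction t with
  | zero => simp
  | add x y hx hy => simp only [map_add, TensorProduct.tmul_add, hx, hy]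
  | tmul p' q' => rfl

theorem comm_legsR (s : A ⊗[k] A) (t : B ⊗[k] B) :
    TensorProduct.comm k _ _ (legsR R T (t ⊗ₜ s)) =
      legsR R T (TensorProduct.comm k B B t ⊗ₜ TensorProduct.comm k A A s) := by
  induction s with
  | zero => simp
  | add x y hx hy => simp only [map_add, TensorProduct.tmul_add, hx, hy]
  | tmul p q =>
  induction t with
  | zero => simp
  | add x y hx hy => simp only [map_add, TensorProduct.add_tmul, hx, hy]
  | tmul p' q' => rfl

theorem hashA_flip {M M' : Multiplier k (A ⊗[k] A)}
    (h : (M' : EndPair k (A ⊗[k] A)) = flipPair M) :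
    hashA R T M' = flipPair (hashA R T M) := by
  refine endPair_ext_legs (legsT R T) (legsR R T) (fun s t => ?_) fun t s => ?_
  · rw [hashA_left_legsT, h]
    change _ = TensorProduct.comm k _ _ ((hashA R T M).1
      (TensorProduct.comm k _ _ (legsT R T (s ⊗ₜ t))))
    rw [comm_legsT, hashA_left_legsT, comm_legsT, comm_comm]
    rfl
  · rw [hashA_right_legsR, h]
    change _ = TensorProduct.comm k _ _ ((hashA R T M).2.unop
      (TensorProduct.comm k _ _ (legsR R T (t ⊗ₜ s))))
    rw [comm_legsR, hashA_right_legsR, comm_legsR, comm_comm]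
    rfl

theorem hashB_flip {N N' : Multiplier k (B ⊗[k] B)}
    (h : (N' : EndPair k (B ⊗[k] B)) = flipPair N) :
    hashB R T N' = flipPair (hashB R T N) := by
  refine endPair_ext_legs (legsR R T) (legsT R T) (fun t s => ?_) fun s t => ?_
  · rw [hashB_left_legsR, h]
    change _ = TensorProduct.comm k _ _ ((hashB R T N).1
      (TensorProduct.comm k _ _ (legsR R T (t ⊗ₜ s))))
    rw [comm_legsR, hashB_left_legsR, comm_legsR, comm_comm]
    rfl
  · rw [hashB_right_legsT, h]
    change _ = TensorProduct.comm k _ _ ((hashB R T N).2.unop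
      (TensorProduct.comm k _ _ (legsT R T (s ⊗ₜ t))))
    rw [comm_legsT, hashB_right_legsT, comm_legsT, comm_comm]
    rfl

theorem lrComul_flip (hRT : IsLRTwisting R T) {HA' : MultiplierHopfAlgebra k A}
    {HB' : MultiplierHopfAlgebra k B}
    (hA : ∀ a, (HA'.comul a : EndPair k (A ⊗[k] A)) = flipPair (HA.comul a))
    (hB : ∀ b, (HB'.comul b : EndPair k (B ⊗[k] B)) = flipPair (HB.comul b))
    (u : LRTensor R T) :
    (lrComul hRT HA' HB' u : EndPair k (LRTensor R T ⊗[k] LRTensor R T)) =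
      flipPair (lrComul hRT HA HB u) := by
  obtain ⟨u, rfl⟩ := (mulBA R T).surjective u
  induction u with
  | zero => simp [flipPair_zero]
  | add x y hx hy => simp only [map_add, Subalgebra.coe_add, flipPair_add, hx, hy]
  | tmul b a =>
    rw [lrComul_mulBA, lrComul_mulBA]
    change hashB R T (HB'.comul b) * hashA R T (HA'.comul a) =
      flipPair (hashB R T (HB.comul b) * hashA R T (HA.comul a))
    rw [flipPair_mul, hashA_flip (hA a), hashB_flip (hB b)]

theorem eq_flipPair {V : Type*} [AddCommGroup V] [Module k V] {X Y : EndPair k (V ⊗[k] V)}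
    (h : ∀ s, Y.1 s = TensorProduct.comm k V V (X.1 (TensorProduct.comm k V V s)) ∧
      Y.2.unop s = TensorProduct.comm k V V (X.2.unop (TensorProduct.comm k V V s))) :
    Y = flipPair X :=
  Prod.ext (LinearMap.ext fun s => (h s).1)
    (MulOpposite.unop_injective (LinearMap.ext fun s => (h s).2))

/-- The comultiplication built from `τ Δ_A` and `τ Δ_B` is `τ Δ`. -/
theorem isRegular_lrMultiplierHopfAlgebra (hRT : IsLRTwisting R T)
    (hl : ∀ u : LRTensor R T, (∀ v, u * v = 0) → u = 0)
    (hr : ∀ u : LRTensor R T, (∀ v, v * u = 0) → u = 0)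
    (hT : ∀ (a : A) (b : B), lrComul hRT HA HB (mulAB R T (a ⊗ₜ b)) =
      hashALin hRT (HA.comul a) * hashBLin hRT (HB.comul b))
    (hA : IsRegular HA) (hB : IsRegular HB) :
    IsRegular (lrMultiplierHopfAlgebra hRT HA HB hl hr hT) := by
  obtain ⟨HA', hA'⟩ := hA
  obtain ⟨HB', hB'⟩ := hB
  have hA : ∀ a, (HA'.comul a : EndPair k (A ⊗[k] A)) = flipPair (HA.comul a) :=
    fun a => eq_flipPair (hA' a)
  have hB : ∀ b, (HB'.comul b : EndPair k (B ⊗[k] B)) = flipPair (HB.comul b) :=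
    fun b => eq_flipPair (hB' b)
  refine ⟨lrMultiplierHopfAlgebra hRT HA' HB' hl hr fun a b => Subtype.ext ?_, fun u s => ?_⟩
  · rw [lrComul_flip hRT hA hB, hT]
    change flipPair (hashA R T (HA.comul a) * hashB R T (HB.comul b)) =
      hashA R T (HA'.comul a) * hashB R T (HB'.comul b)
    rw [flipPair_mul, hashA_flip (hA a), hashB_flip (hB b)]
  · have h := lrComul_flip hRT hA hB u
    exact ⟨LinearMap.congr_fun (congrArg Prod.fst h) s,
      LinearMap.congr_fun (congrArg (fun X => X.2.unop) h) s⟩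

end Twisted

end MultHopf

end

open MultHopf in
theorem theorem2p1p12 {k A B : Type*} [Field k]
    [NonUnitalRing A] [Module k A] [IsScalarTower k A A] [SMulCommClass k A A]
    [NonUnitalRing B] [Module k B] [IsScalarTower k B B] [SMulCommClass k B B]
    -- the multiplier Hopf algebras, with their counits and antipodes
    (HA : MultiplierHopfAlgebra k A) (HB : MultiplierHopfAlgebra k B)
    (εA : A →ₗ[k] k) (εB : B →ₗ[k] k) (hεA : IsCounit HA εA) (hεB : IsCounit HB εB)
    (SA : A →ₗ[k] A) (SB : B →ₗ[k] B) (hSA : IsAntipode HA εA SA) (hSB : IsAntipode HB εB SB)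
    -- the bijections `R` and `T`
    (R : (B ⊗[k] A) ≃ₗ[k] (A ⊗[k] B)) (T : (A ⊗[k] B) ≃ₗ[k] (A ⊗[k] B))
    (hRT : IsLRTwisting R T)
    -- the nondegeneracy conditions
    (hTR_nondeg : ∀ u : A ⊗[k] B,
      (∀ (a : A) (b : B), TstarR R T (u ⊗ₜ (a ⊗ₜ b)) = 0) → u = 0)
    (hRT_nondeg : ∀ u : A ⊗[k] B,
      (∀ (a : A) (b : B), RstarT R T ((a ⊗ₜ b) ⊗ₜ u) = 0) → u = 0)
    -- `Δ_{RT}(R(x ⊗ a)) = ((1 ⊗ 1) # Δ_B(x)) (Δ_A(a) # (1 ⊗ 1))`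
    (hR_comul : ∀ (x : B) (a : A), IsComul R T HA HB (hash R T (R (x ⊗ₜ a)))
      (hashB R T (HB.comul x) * hashA R T (HA.comul a)))
    -- `Δ_{RT} ∘ T = (T ⊗ T) ∘ Δ_{RT}`: as `T(a ⊗ x) = (a # 1)(1 # x)`, the right-hand side at
    -- `a ⊗ x` is the multiplier `(Δ_A(a) # (1 ⊗ 1)) ((1 ⊗ 1) # Δ_B(x))`
    (hT_comul : ∀ (a : A) (x : B), IsComul R T HA HB (hash R T (T (a ⊗ₜ x)))
      (hashA R T (HA.comul a) * hashB R T (HB.comul x)))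
    -- `(T * R) ∘ (S_A ⊗ S_B ⊗ id) ∘ Δ_{RT} = (1 # 1) ε_{RT}`, as multipliers applied to `w`
    (hTR_antipode : ∀ (u w : LRTensor R T) (Z : LRTensor R T ⊗[k] LRTensor R T),
      IsComulMulOneTmul R T HA HB u w Z →
      hash R T (TstarR R T ((TensorProduct.map SA SB).rTensor (A ⊗[k] B) ((hash₂ R T).symm Z))) =
        lrCounit R T εA εB u • w)
    -- `(R * T) ∘ (id ⊗ S_A ⊗ S_B) ∘ Δ_{RT} = (1 # 1) ε_{RT}`, as multipliers applied to `w`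
    (hRT_antipode : ∀ (u w : LRTensor R T) (Z : LRTensor R T ⊗[k] LRTensor R T),
      IsTmulOneMulComul R T HA HB w u Z →
      hash R T (RstarT R T ((TensorProduct.map SA SB).lTensor (A ⊗[k] B) ((hash₂ R T).symm Z))) =
        lrCounit R T εA εB u • w) :
    ∃ H : MultiplierHopfAlgebra k (LRTensor R T),
      (∀ (u : LRTensor R T) (X : EndPair k (LRTensor R T ⊗[k] LRTensor R T)),
        IsComul R T HA HB u X ↔ X = H.comul u) ∧
      IsCounit H (lrCounit R T εA εB) ∧
      IsAntipode H (lrCounit R T εA εB) (lrAntipode R T SA SB) ∧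
      (IsRegular HA → IsRegular HB → IsRegular H) := by
  have hl := lr_nondeg_left hRT hTR_nondeg
  have hr := lr_nondeg_right hRT hRT_nondeg
  have hΔ := isComul_lrComul hRT hR_comul
  have hT : ∀ (a : A) (b : B), lrComul hRT HA HB (mulAB R T (a ⊗ₜ b)) =
      hashALin hRT (HA.comul a) * hashBLin hRT (HB.comul b) := fun a b =>
    Subtype.ext ((hΔ _).unique hl hr (hT_comul a b))
  let H := lrMultiplierHopfAlgebra hRT HA HB hl hr hT
  -- `T₁` and `T₂` are given by the formula `Δ_{RT}(a # x) = (a₁ # x₁) ⊗ (a₂ # x₂)`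
  have hT₁ : ∀ u w, IsComulMulOneTmul R T HA HB u w (H.T₁ (u ⊗ₜ w)) := fun u w => by
    obtain ⟨Z, h1, h2⟩ := (hΔ u).1 w
    rwa [(H.T₁_spec u w).unique hl h1]
  have hT₂ : ∀ w u, IsTmulOneMulComul R T HA HB w u (H.T₂ (w ⊗ₜ u)) := fun w u => by
    obtain ⟨Z, h1, h2⟩ := (hΔ u).2 w
    rwa [(H.T₂_spec w u).unique hr h1]
  have hε_left := fun u w => (hT₁ u w).lid_counit hεA hεB
  have hε := H.counit_mul (lrCounit R T εA εB) hε_left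
  have hS_left : ∀ u w, LinearMap.mul' k (LRTensor R T)
      ((lrAntipode R T SA SB).rTensor (LRTensor R T) (H.T₁ (u ⊗ₜ w))) =
        lrCounit R T εA εB u • w := fun u w =>
    (hash_TstarR_antipode hRT SA SB _).symm.trans (hTR_antipode u w _ (hT₁ u w))
  refine ⟨H, fun u X => ⟨fun h => h.unique hl hr (hΔ u), fun h => h ▸ hΔ u⟩,
    ⟨hε, hε_left, fun w u => (hT₂ w u).rid_counit hεA hεB⟩,
    ⟨H.antipode_mul _ hε _ hS_left, hS_left, fun w u => ?_⟩,
    isRegular_lrMultiplierHopfAlgebra hRT hl hr hT⟩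
  exact (hash_RstarT_antipode hRT SA SB _).symm.trans (hRT_antipode u w _ (hT₂ w u))
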